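/- Let $G$ and $H$ be complex Lie groups, $P\subset G$ a closed complex Lie subgroup, and $X$ a complex manifold (for instance: $G$ a connected simply connected semisimple complex affine algebraic group, $P\subsetneq G$ a parabolic subgroup, $H$ a connected reductive complex affine algebraic group, and $X$ a smooth irreducible complex projective variety). Give $G/P$ the complex structure for which $G\to G/P$ is a holomorphic submersion, and put $o=P/P\in G/P$. Let $G$ act on $X\times G/P$ by $g\cdot(x,y)=(x,gy)$, and let $P$ act trivially on $X$. For a complex Lie group $K$ acting on a complex manifold $M$, a $K$-equivariant holomorphic principal $H$-bundle on $M$ is a holomorphic (locally trivial) principal $H$-bundle $\pi\colon E\to M$ (with right $H$-action) together with a holomorphic left action of $K$ on $E$ which lifts the action on $M$ and commutes with the action of $H$. These bundles form a groupoid, whose morphisms are the $K$-equivariant isomorphisms of holomorphic principal $H$-bundles over $\operatorname{id}_M$. Then the groupoid of $G$-equivariant holomorphic principal $H$-bundles on $X\times G/P$ is equivalent to the groupoid of $P$-equivariant holomorphic principal $H$-bundles on $X$. More precisely, there are mutually quasi-inverse functors $\mathrm{Res}$ and $\mathrm{Ind}$ with the following properties. (1) For a $G$-equivariant bundle $E'_H$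 on $X\times G/P$, $\mathrm{Res}(E'_H)$ is the restriction of $E'_H$ to the slice $X\cong X\times\{o\}$, with the restricted $P$-action. That is, there is a holomorphic embedding $j\colon\mathrm{Res}(E'_H)\to E'_H$ with image the part of $E'_H$ over $X\times\{o\}$, which is $H$- and $P$-equivariant and covers $x\mapsto(x,o)$; it is natural in $E'_H$. (2) For a $P$-equivariant bundle $E_H$ on $X$, let $p_1\colon X\times G\to X$ be the projection, so that $p_1^*E_H=E_H\times G$, with $P$ acting by $p\cdot(e,g)=(p\cdot e,\,gp^{-1})$ and $G$ acting by $g'\cdot(e,g)=(e,g'g)$. Then $\mathrm{Ind}(E_H)$ is the quotient $(p_1^*E_H)/P$, as a bundle on $X\times G/P$. That is, there is a surjective holomorphic submersion $q\colon p_1^*E_H\to\mathrm{Ind}(E_H)$ whose fibres are exactly the $P$-orbits, which is $H$- and $G$-equivariant and covers $(x,g)\mapsto(x,gP)$; it is natural in $E_H$. (3) The natural isomorphisms of the equivalence are the canonical ones: $E'_H\to\mathrm{Ind}(\mathrm{Res}(E'_H))$ sends $g\cdot j(e)$ to $q(e,g)$, and $E_H\to\mathrm{Res}(\mathrm{Ind}(E_H))$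 sends $e$ to the point $e'$ with $j(e')=q(e,1)$. -/

import Mathlib

open scoped Manifold ContDiff
open CategoryTheory

universe u

/-- Let `K` and `S` be complex Lie groups and `M` a complex manifold on which `K` acts by `act`.
A `K`-equivariant holomorphic principal `S`-bundle over `M` is a holomorphic principal `S`-bundle
`proj : Total → M` with (right) structure group action `ract`, together with a holomorphic left
action `lact` of `K` on `Total` that lifts `act` and commutes with the action of `S`.
Holomorphic means complex analytic (`ContMDiff _ _ ω` over `ℂ`). The total space is a manifold
modelled on (model of `M`) × (model of `S`). -/
structure EquivariantPrincipalBundle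
    {VK AK VM AM VS AS : Type*}
    [NormedAddCommGroup VK] [NormedSpace ℂ VK] [TopologicalSpace AK]
    [NormedAddCommGroup VM] [NormedSpace ℂ VM] [TopologicalSpace AM]
    [NormedAddCommGroup VS] [NormedSpace ℂ VS] [TopologicalSpace AS]
    (IK : ModelWithCorners ℂ VK AK) (IM : ModelWithCorners ℂ VM AM)
    (IS : ModelWithCorners ℂ VS AS)
    (K M S : Type u)
    [TopologicalSpace K] [ChartedSpace AK K] [Group K]
    [TopologicalSpace M] [ChartedSpace AM M]
    [TopologicalSpace S] [ChartedSpace AS S] [Group S]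
    (act : K → M → M) where
  /-- The total space. -/
  Total : Type u
  [topologicalSpace : TopologicalSpace Total]
  [chartedSpace : ChartedSpace (ModelProd AM AS) Total]
  [isManifold : IsManifold (IM.prod IS) ω Total]
  /-- The bundle projection. -/
  proj : Total → M
  contMDiff_proj : ContMDiff (IM.prod IS) IM ω proj
  /-- The right action of the structure group. -/
  ract : Total → S → Total
  ract_one : ∀ z, ract z 1 = z
  ract_mul : ∀ z s t, ract z (s * t) = ract (ract z s) t
  proj_ract : ∀ z s, proj (ract z s) = proj z
  contMDiff_ract : ContMDiff ((IM.prod IS).prod IS) (IM.prod IS) ω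
    (fun w : Total × S => ract w.1 w.2)
  /-- Near every point of the base there is an `S`-equivariant biholomorphic trivialization. -/
  locally_trivial : ∀ x : M, ∃ e : Bundle.Trivialization S proj, x ∈ e.baseSet ∧
    ContMDiffOn (IM.prod IS) (IM.prod IS) ω e e.source ∧
    ContMDiffOn (IM.prod IS) (IM.prod IS) ω e.toOpenPartialHomeomorph.symm e.target ∧
    ∀ z ∈ e.source, ∀ s : S, (e (ract z s)).2 = (e z).2 * s
  /-- The left action of `K` on the total space. -/
  lact : K → Total → Total
  lact_one : ∀ z, lact 1 z = z
  lact_mul : ∀ k l z, lact (k * l) z = lact k (lact l z)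
  proj_lact : ∀ k z, proj (lact k z) = act k (proj z)
  lact_ract : ∀ k z s, lact k (ract z s) = ract (lact k z) s
  contMDiff_lact : ContMDiff (IK.prod (IM.prod IS)) (IM.prod IS) ω
    (fun w : K × Total => lact w.1 w.2)

namespace EquivariantPrincipalBundle

attribute [instance] topologicalSpace chartedSpace isManifold

section Groupoid

variable {VK AK VM AM VS AS : Type*}
  [NormedAddCommGroup VK] [NormedSpace ℂ VK] [TopologicalSpace AK]
  [NormedAddCommGroup VM] [NormedSpace ℂ VM] [TopologicalSpace AM]
  [NormedAddCommGroup VS] [NormedSpace ℂ VS] [TopologicalSpace AS]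
  {IK : ModelWithCorners ℂ VK AK} {IM : ModelWithCorners ℂ VM AM}
  {IS : ModelWithCorners ℂ VS AS}
  {K M S : Type u}
  [TopologicalSpace K] [ChartedSpace AK K] [Group K]
  [TopologicalSpace M] [ChartedSpace AM M]
  [TopologicalSpace S] [ChartedSpace AS S] [Group S]
  {act : K → M → M}

/-- A `K`-equivariant isomorphism of holomorphic principal `S`-bundles over `M`: a biholomorphic
map of total spaces over the identity of `M` which commutes with the actions of `S` and `K`. -/
@[ext]
structure Hom (E F : EquivariantPrincipalBundle IK IM IS K M S act) where
  /-- The underlying biholomorphic map. -/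
  toDiffeomorph : Diffeomorph (IM.prod IS) (IM.prod IS) E.Total F.Total ω
  proj_map : ∀ z, F.proj (toDiffeomorph z) = E.proj z
  map_ract : ∀ z s, toDiffeomorph (E.ract z s) = F.ract (toDiffeomorph z) s
  map_lact : ∀ k z, toDiffeomorph (E.lact k z) = F.lact k (toDiffeomorph z)

noncomputable instance (E F : EquivariantPrincipalBundle IK IM IS K M S act) :
    CoeFun (Hom E F) (fun _ => E.Total → F.Total) :=
  ⟨fun f => f.toDiffeomorph⟩

/-- The groupoid of `K`-equivariant holomorphic principal `S`-bundles over `M`. -/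
noncomputable instance : Groupoid (EquivariantPrincipalBundle IK IM IS K M S act) where
  Hom E F := Hom E F
  id E :=
    { toDiffeomorph := Diffeomorph.refl _ _ _
      proj_map := fun _ => rfl
      map_ract := fun _ _ => rfl
      map_lact := fun _ _ => rfl }
  comp f g :=
    { toDiffeomorph := f.toDiffeomorph.trans g.toDiffeomorph
      proj_map := fun z => (g.proj_map _).trans (f.proj_map z)
      map_ract := fun z s => (congrArg g.toDiffeomorph (f.map_ract z s)).trans (g.map_ract _ s)
      map_lact := fun k z => (congrArg g.toDiffeomorph (f.map_lact k z)).trans (g.map_lact k _) }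
  id_comp f := Hom.ext (Diffeomorph.ext fun _ => rfl)
  comp_id f := Hom.ext (Diffeomorph.ext fun _ => rfl)
  assoc f g h := Hom.ext (Diffeomorph.ext fun _ => rfl)
  inv f :=
    { toDiffeomorph := f.toDiffeomorph.symm
      proj_map := fun z => by
        rw [← f.proj_map, Diffeomorph.apply_symm_apply]
      map_ract := fun z s => by
        have h := f.map_ract (f.toDiffeomorph.symm z) s
        rw [Diffeomorph.apply_symm_apply] at h
        rw [← h, Diffeomorph.symm_apply_apply]
      map_lact := fun k z => by
        have h := f.map_lact k (f.toDiffeomorph.symm z)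
        rw [Diffeomorph.apply_symm_apply] at h
        rw [← h, Diffeomorph.symm_apply_apply] }
  inv_comp f := Hom.ext (Diffeomorph.ext fun z => f.toDiffeomorph.apply_symm_apply z)
  comp_inv f := Hom.ext (Diffeomorph.ext fun z => f.toDiffeomorph.symm_apply_apply z)

/-- The map of total spaces underlying a morphism of the groupoid. -/
noncomputable def mapTotal {E F : EquivariantPrincipalBundle IK IM IS K M S act} (f : E ⟶ F) :
    E.Total → F.Total :=
  Hom.toDiffeomorph f

end Groupoid

end EquivariantPrincipalBundle

section InductionReduction

open EquivariantPrincipalBundle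

variable (VX VG VP VQ VH : Type*)
  [NormedAddCommGroup VX] [NormedSpace ℂ VX]
  [NormedAddCommGroup VG] [NormedSpace ℂ VG]
  [NormedAddCommGroup VP] [NormedSpace ℂ VP]
  [NormedAddCommGroup VQ] [NormedSpace ℂ VQ]
  [NormedAddCommGroup VH] [NormedSpace ℂ VH]
  (X : Type u) [TopologicalSpace X] [ChartedSpace VX X]
  {G : Type u} [TopologicalSpace G] [ChartedSpace VG G] [Group G]
  (P : Subgroup G) [ChartedSpace VP P] [ChartedSpace VQ (G ⧸ P)]
  (H : Type u) [TopologicalSpace H] [ChartedSpace VH H] [Group H]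

/-- The groupoid of `G`-equivariant holomorphic principal `H`-bundles on `X × G/P`, where `G` acts
trivially on `X` and by left translation on `G/P`. -/
abbrev BunProductFlag :=
  EquivariantPrincipalBundle 𝓘(ℂ, VG) (𝓘(ℂ, VX).prod 𝓘(ℂ, VQ)) 𝓘(ℂ, VH)
    G (X × (G ⧸ P)) H (fun g w => (w.1, g • w.2))

/-- The groupoid of `P`-equivariant holomorphic principal `H`-bundles on `X`, where `P` acts
trivially on `X`. -/
abbrev BunTrivialAction :=
  EquivariantPrincipalBundle 𝓘(ℂ, VP) 𝓘(ℂ, VX) 𝓘(ℂ, VH) P X H (fun _ x => x)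

variable {VX VG VP VQ VH X P H}

/-- `j : E → E'` exhibits the `P`-equivariant bundle `E` on `X` as the restriction of the
`G`-equivariant bundle `E'` on `X × G/P` to the slice `X ≅ X × {o}`, `o = P/P`: it identifies
(the complex manifold) `E` with the complex submanifold of `E'` lying over `X × {o}`, with
the restricted projection, `H`-action and `P`-action. -/
structure IsSliceRestriction (E' : BunProductFlag VX VG VQ VH X P H)
    (E : BunTrivialAction VX VP VH X P H) (j : E.Total → E'.Total) : Prop where
  isSmoothEmbedding : Manifold.IsSmoothEmbedding (𝓘(ℂ, VX).prod 𝓘(ℂ, VH))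
    ((𝓘(ℂ, VX).prod 𝓘(ℂ, VQ)).prod 𝓘(ℂ, VH)) ω j
  range_eq : Set.range j = {z | (E'.proj z).2 = ((1 : G) : G ⧸ P)}
  proj_map : ∀ e, E'.proj (j e) = (E.proj e, ((1 : G) : G ⧸ P))
  map_ract : ∀ e h, j (E.ract e h) = E'.ract (j e) h
  map_lact : ∀ (p : P) e, j (E.lact p e) = E'.lact (p : G) (j e)

/-- Let `E` be a `P`-equivariant bundle on `X` and `p₁ : X × G → X` the projection, so that
`p₁^* E = E × G` as a bundle over `X × G`. The group `P` acts on it by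
`p · (e, g) = (p · e, g p⁻¹)` and `G` acts on it by `g' · (e, g) = (e, g' g)`.
The map `q : E × G → E'` exhibits the `G`-equivariant bundle `E'` on `X × G/P` as the quotient
`(p₁^* E)/P`: it is a surjective holomorphic submersion whose fibres are the `P`-orbits, and the
projection, the `H`-action and the `G`-action of `E'` are those induced from `p₁^* E`. -/
structure IsInduction (E : BunTrivialAction VX VP VH X P H)
    (E' : BunProductFlag VX VG VQ VH X P H) (q : E.Total × G → E'.Total) : Prop where
  surjective : Function.Surjective q
  isSubmersion : Manifold.IsSubmersion ((𝓘(ℂ, VX).prod 𝓘(ℂ, VH)).prod 𝓘(ℂ, VG))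
    ((𝓘(ℂ, VX).prod 𝓘(ℂ, VQ)).prod 𝓘(ℂ, VH)) ω q
  eq_iff : ∀ e₁ g₁ e₂ g₂,
    q (e₁, g₁) = q (e₂, g₂) ↔ ∃ p : P, e₂ = E.lact p e₁ ∧ g₂ = g₁ * (p : G)⁻¹
  proj_map : ∀ e g, E'.proj (q (e, g)) = (E.proj e, (g : G ⧸ P))
  map_ract : ∀ e g h, q (E.ract e h, g) = E'.ract (q (e, g)) h
  map_lact : ∀ g' e g, q (e, g' * g) = E'.lact g' (q (e, g))

end InductionReduction

/-! Over `X × G/P` the group `G` moves the slice `X × {o}` onto every other slice, and `P` is the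
stabiliser of `o`. So a `G`-equivariant bundle `E'` is recovered from its restriction `E` to that
slice: `(e, g) ↦ g · e` maps `E × G` onto `E'`, and its fibres are the orbits of `P`. Conversely `(E
× G)/P` makes sense for every `P`-equivariant `E`, and its part over `o` is `E` again.

The formal half treats both constructions through mapping properties. A holomorphic map landing in
the slice lifts through the embedding `j` (`IsSliceRestriction.exists_hom`); a `P`-invariant
holomorphic map on `E × G` descends along the surjective submersion `q` (`IsInduction.exists_hom`).
Equivariant holomorphic maps over the identity are automatically isomorphisms (`homOfContMDiff`), so
functoriality, naturality and the triangle identity reduce to comparing values after `j` or on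
classes `q (e, g)`: `exists_equivalence_of_isSliceRestriction_of_isInduction`.

The analytic half is existence (`exists_isSliceRestriction`, `exists_isInduction`). Both total
spaces get their complex structure from trivializations with holomorphic transition maps
(`exists_chartedSpace_of_compatible`). For the slice these are restrictions of trivializations of
`E'`. For the quotient, a local holomorphic section `σ` of `G → G/P` writes `g = σ(gP) p`, and `[(e,
g)] ↦ (p · e, gP)` identifies the quotient locally with `E × G/P`. -/

section

open Manifold Set Filter Topology

/-! ### Immersions, submersions and gluing of charts on manifolds -/

section GeneralManifolds

variable {𝕜 : Type*} [NontriviallyNormedField 𝕜]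
  {E : Type*} [NormedAddCommGroup E] [NormedSpace 𝕜 E] {A : Type*} [TopologicalSpace A]
  {I : ModelWithCorners 𝕜 E A}
  {E' : Type*} [NormedAddCommGroup E'] [NormedSpace 𝕜 E'] {A' : Type*} [TopologicalSpace A']
  {J : ModelWithCorners 𝕜 E' A'}
  {E'' : Type*} [NormedAddCommGroup E''] [NormedSpace 𝕜 E''] {A'' : Type*} [TopologicalSpace A'']
  {J' : ModelWithCorners 𝕜 E'' A''}
  {F : Type*} [NormedAddCommGroup F] [NormedSpace 𝕜 F]
  {M M' : Type*} [TopologicalSpace M] [ChartedSpace A M] [TopologicalSpace M'] [ChartedSpace A M']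
  {N N' : Type*} [TopologicalSpace N] [ChartedSpace A' N] [TopologicalSpace N'] [ChartedSpace A' N']
  {Z : Type*} [TopologicalSpace Z] [ChartedSpace A'' Z]
  {n : ℕ∞ω}

/-- Composing a partial diffeomorphism with a chart of the maximal atlas gives a chart of the
maximal atlas. -/
theorem OpenPartialHomeomorph.trans_mem_maximalAtlas [IsManifold I n M']
    (Φ : OpenPartialHomeomorph M' M) (hΦ : ContMDiffOn I I n Φ Φ.source)
    (hΦ' : ContMDiffOn I I n Φ.symm Φ.target) {c : OpenPartialHomeomorph M A}
    (hc : c ∈ IsManifold.maximalAtlas I n M) :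
    Φ ≫ₕ c ∈ IsManifold.maximalAtlas I n M' := by
  refine OpenPartialHomeomorph.mem_maximalAtlas_of_contMDiffOn _ ?_ ?_
  · exact (contMDiffOn_of_mem_maximalAtlas hc).comp (hΦ.mono (by simp)) (by intro y hy; simp_all)
  · exact hΦ'.comp ((contMDiffOn_symm_of_mem_maximalAtlas hc).mono (by simp))
      (by intro y hy; simp_all)

/-- If `f'` is conjugate to a submersion by partial diffeomorphisms, it is a submersion. -/
theorem Manifold.IsSubmersionAtOfComplement.of_conj [IsManifold I n M'] [IsManifold J n N']
    {f : M → N} {f' : M' → N'}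
    (Φ : OpenPartialHomeomorph M' M) (hΦ : ContMDiffOn I I n Φ Φ.source)
    (hΦ' : ContMDiffOn I I n Φ.symm Φ.target)
    (Ψ : OpenPartialHomeomorph N' N) (hΨ : ContMDiffOn J J n Ψ Ψ.source)
    (hΨ' : ContMDiffOn J J n Ψ.symm Ψ.target)
    (hmaps : ∀ y ∈ Φ.source, f' y ∈ Ψ.source) (hconj : ∀ y ∈ Φ.source, Ψ (f' y) = f (Φ y))
    {x : M'} (hx : x ∈ Φ.source) (h : IsSubmersionAtOfComplement F I J n f (Φ x)) :
    IsSubmersionAtOfComplement F I J n f' x := by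
  refine .mk_of_charts h.equiv (Φ ≫ₕ h.domChart) (Ψ ≫ₕ h.codChart) ?_ ?_
    (Φ.trans_mem_maximalAtlas hΦ hΦ' h.domChart_mem_maximalAtlas)
    (Ψ.trans_mem_maximalAtlas hΨ hΨ' h.codChart_mem_maximalAtlas) ?_ ?_
  · simp [hx, h.mem_domChart_source]
  · simp [hmaps x hx, hconj x hx, h.mem_codChart_source]
  · intro y hy
    simp only [OpenPartialHomeomorph.trans_source, mem_inter_iff, mem_preimage] at hy ⊢
    exact ⟨hmaps y hy.1, by rw [hconj y hy.1]; exact h.source_subset_preimage_source hy.2⟩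
  · intro u hu
    simp only [OpenPartialHomeomorph.extend_target, OpenPartialHomeomorph.trans_target,
      mem_inter_iff, mem_preimage] at hu
    have hu' : u ∈ (h.domChart.extend I).target := by
      rw [OpenPartialHomeomorph.extend_target]; exact ⟨hu.1.1, hu.2⟩
    have := h.writtenInCharts hu'
    simp only [Function.comp_apply, OpenPartialHomeomorph.extend_coe,
      OpenPartialHomeomorph.extend_coe_symm, OpenPartialHomeomorph.coe_trans,
      OpenPartialHomeomorph.coe_trans_symm] at this ⊢
    rw [hconj _ (Φ.map_target hu.1.2), Φ.right_inv hu.1.2, this]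

/-- If `f'` is conjugate to an immersion by partial diffeomorphisms, it is an immersion. -/
theorem Manifold.IsImmersionAtOfComplement.of_conj [IsManifold I n M'] [IsManifold J n N']
    {f : M → N} {f' : M' → N'}
    (Φ : OpenPartialHomeomorph M' M) (hΦ : ContMDiffOn I I n Φ Φ.source)
    (hΦ' : ContMDiffOn I I n Φ.symm Φ.target)
    (Ψ : OpenPartialHomeomorph N' N) (hΨ : ContMDiffOn J J n Ψ Ψ.source)
    (hΨ' : ContMDiffOn J J n Ψ.symm Ψ.target)
    (hmaps : ∀ y ∈ Φ.source, f' y ∈ Ψ.source) (hconj : ∀ y ∈ Φ.source, Ψ (f' y) = f (Φ y))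
    {x : M'} (hx : x ∈ Φ.source) (h : IsImmersionAtOfComplement F I J n f (Φ x)) :
    IsImmersionAtOfComplement F I J n f' x := by
  refine .mk_of_charts h.equiv (Φ ≫ₕ h.domChart) (Ψ ≫ₕ h.codChart) ?_ ?_
    (Φ.trans_mem_maximalAtlas hΦ hΦ' h.domChart_mem_maximalAtlas)
    (Ψ.trans_mem_maximalAtlas hΨ hΨ' h.codChart_mem_maximalAtlas) ?_ ?_
  · simp [hx, h.mem_domChart_source]
  · simp [hmaps x hx, hconj x hx, h.mem_codChart_source]
  · intro y hy
    simp only [OpenPartialHomeomorph.trans_source, mem_inter_iff, mem_preimage] at hy ⊢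
    exact ⟨hmaps y hy.1, by rw [hconj y hy.1]; exact h.source_subset_preimage_source hy.2⟩
  · intro u hu
    simp only [OpenPartialHomeomorph.extend_target, OpenPartialHomeomorph.trans_target,
      mem_inter_iff, mem_preimage] at hu
    have hu' : u ∈ (h.domChart.extend I).target := by
      rw [OpenPartialHomeomorph.extend_target]; exact ⟨hu.1.1, hu.2⟩
    have := h.writtenInCharts hu'
    simp only [Function.comp_apply, OpenPartialHomeomorph.extend_coe,
      OpenPartialHomeomorph.extend_coe_symm, OpenPartialHomeomorph.coe_trans,
      OpenPartialHomeomorph.coe_trans_symm] at this ⊢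
    rw [hconj _ (Φ.map_target hu.1.2), Φ.right_inv hu.1.2, this]

/-- A submersion has `C^n` local sections through every point. -/
theorem Manifold.IsSubmersionAtOfComplement.exists_localSection [I.Boundaryless]
    {f : M → N} {x : M} (h : IsSubmersionAtOfComplement F I J n f x) :
    ∃ (s : N → M) (U : Set N), IsOpen U ∧ f x ∈ U ∧ s (f x) = x ∧ ContMDiffOn J I n s U ∧
      ∀ y ∈ U, f (s y) = y := by
  -- The section freezes the `F`-coordinate at its value at `x`, so that it passes through `x`.
  set v : F := (h.equiv (h.domChart.extend I x)).2
  set k : N → E := fun y ↦ h.equiv.symm (h.codChart.extend J y, v)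
  have hk : ContMDiffOn J 𝓘(𝕜, E) n k h.codChart.source := by
    have h1 : ContMDiffOn J 𝓘(𝕜, E') n (h.codChart.extend J) h.codChart.source :=
      OpenPartialHomeomorph.contMDiffOn_extend h.codChart_mem_maximalAtlas
    have h2 : ContMDiff 𝓘(𝕜, E') 𝓘(𝕜, E) n (fun w : E' ↦ h.equiv.symm (w, v)) := by
      rw [contMDiff_iff_contDiff]; fun_prop
    exact h2.comp_contMDiffOn h1
  have hxt : h.domChart.extend I x ∈ (h.domChart.extend I).target :=
    (h.domChart.extend I).map_source (by simpa using h.mem_domChart_source)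
  have hkx : k (f x) = h.domChart.extend I x := by
    have h1 := h.writtenInCharts hxt
    simp only [Function.comp_apply] at h1
    rw [OpenPartialHomeomorph.extend_left_inv _ h.mem_domChart_source] at h1
    simp only [k, v, h1, Prod.mk.eta, ContinuousLinearEquiv.symm_apply_apply]
  -- Without boundary the target of the extended chart is open, which makes the domain of the
  -- section open.
  refine ⟨fun y ↦ (h.domChart.extend I).symm (k y),
    h.codChart.source ∩ k ⁻¹' (h.domChart.extend I).target,
    hk.continuousOn.isOpen_inter_preimage h.codChart.open_source
      h.domChart.isOpen_extend_target, ⟨h.mem_codChart_source, ?_⟩, ?_, ?_, ?_⟩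
  · rw [mem_preimage, hkx]; exact hxt
  · simp only [hkx]; exact OpenPartialHomeomorph.extend_left_inv _ h.mem_domChart_source
  · refine (contMDiffOn_extend_symm h.domChart_mem_maximalAtlas).comp
      (hk.mono inter_subset_left) fun y hy ↦ ?_
    have := hy.2
    rw [mem_preimage, OpenPartialHomeomorph.extend_target, ← I.image_eq] at this
    exact this
  · rintro y ⟨hy, hky⟩
    have h1 := h.writtenInCharts hky
    simp only [Function.comp_apply, k, ContinuousLinearEquiv.apply_symm_apply] at h1
    have h2 : (h.domChart.extend I).symm (k y) ∈ h.domChart.source := by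
      simpa using (h.domChart.extend I).map_target hky
    exact (h.codChart.extend J).injOn
      (by simpa using h.source_subset_preimage_source h2) (by simpa using hy) h1

/-- A map whose composition with a surjective submersion is `C^n` is itself `C^n`. -/
theorem Manifold.IsSubmersion.contMDiff_of_comp [I.Boundaryless] {f : M → N}
    (hf : IsSubmersion I J n f) (hs : Function.Surjective f) {g : N → Z}
    (hg : ContMDiff I J' n (g ∘ f)) : ContMDiff J J' n g := by
  intro y
  obtain ⟨x, rfl⟩ := hs y
  obtain ⟨s, U, hU, hxU, -, hsm, hsec⟩ :=
    (hf.isSubmersionOfComplement_complement x).exists_localSection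
  -- Near `f x`, `g` equals `(g ∘ f) ∘ s` for a local section `s`.
  have h1 : ContMDiffOn J J' n ((g ∘ f) ∘ s) U := hg.comp_contMDiffOn hsm
  exact (h1.congr fun y hy ↦ by simp [hsec y hy]).contMDiffAt (hU.mem_nhds hxU)

/-- A map into the source of a `C^n` embedding is `C^n` if its composition with the embedding
is. -/
theorem Manifold.IsSmoothEmbedding.contMDiff_of_comp {f : N → Z} (hf : IsSmoothEmbedding J J' n f)
    {g : M → N} (hg : ContMDiff I J' n (f ∘ g)) : ContMDiff I J n g :=
  -- The immersion property handles only continuous `g`; continuity comes from the embedding being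
  -- inducing.
  (ContMDiff.iff_comp_isImmersion hf.isImmersion).2
    ⟨hf.isEmbedding.isInducing.continuous_iff.2 hg.continuous, hg⟩

/-- Local version, needed for `CosetSection.toSubgroup`, whose holomorphy is available only over the
domain of a section. -/
theorem Manifold.IsSmoothEmbedding.contMDiffOn_of_comp {f : N → Z}
    (hf : IsSmoothEmbedding J J' n f) {g : M → N} {U : Set M} (hU : IsOpen U)
    (hg : ContMDiffOn I J' n (f ∘ g) U) : ContMDiffOn I J n g U := by
  intro x hx
  have h := hg.contMDiffAt (hU.mem_nhds hx)
  exact ((ContMDiffAt.iff_comp_isImmersionAt (hf.isImmersion.isImmersionAt (g x))).2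
    ⟨hf.isEmbedding.isInducing.continuousAt_iff.2 h.continuousAt, h⟩).contMDiffWithinAt

/-- A topological space covered by the sources of partial homeomorphisms to a manifold `M`, with
`C^n` transition maps, is a manifold for which these are partial diffeomorphisms. -/
theorem exists_chartedSpace_of_compatible {T : Type*} [TopologicalSpace T] [IsManifold I n M]
    {ι : Type*} (φ : ι → OpenPartialHomeomorph T M) (hcov : ∀ z, ∃ i, z ∈ (φ i).source)
    (hφ : ∀ i j, ContMDiffOn I I n ((φ i).symm ≫ₕ φ j) ((φ i).symm ≫ₕ φ j).source) :
    ∃ c : ChartedSpace A T, letI := c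
      IsManifold I n T ∧ ∀ i, ContMDiffOn I I n (φ i) (φ i).source ∧
        ContMDiffOn I I n (φ i).symm (φ i).target := by
  choose idx hidx using hcov
  let c : ChartedSpace A T :=
    { atlas := {e | ∃ i y, e = φ i ≫ₕ chartAt A y}
      chartAt := fun z ↦ φ (idx z) ≫ₕ chartAt A (φ (idx z) z)
      mem_chart_source := fun z ↦ by simp [hidx z]
      chart_mem_atlas := fun z ↦ ⟨_, _, rfl⟩ }
  have hman : IsManifold I n T := by
    refine isManifold_of_contDiffOn I n T ?_
    rintro _ _ ⟨i, y, rfl⟩ ⟨j, y', rfl⟩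
    -- A change of charts is a transition map of the `φ i` between two charts of `M` and the model
    -- map `I`; each factor is `C^n`.
    rw [← contMDiffOn_iff_contDiffOn]
    apply I.contMDiff.comp_contMDiffOn
    have h1 : ContMDiffOn 𝓘(𝕜, E) I n I.symm (range I) := I.contMDiffOn_symm
    have h2 : ContMDiffOn I I n (chartAt A y).symm (chartAt A y).target := contMDiffOn_chart_symm
    have h3 : ContMDiffOn I I n (chartAt A y') (chartAt A y').source := contMDiffOn_chart
    refine h3.comp (t := (chartAt A y').source) ((hφ i j).comp
      (h2.comp (h1.mono inter_subset_right) ?_) ?_) ?_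
    all_goals
      intro w hw
      simp only [OpenPartialHomeomorph.trans_source, OpenPartialHomeomorph.trans_symm_eq_symm_trans_symm,
        OpenPartialHomeomorph.symm_source, mem_inter_iff, mem_preimage,
        OpenPartialHomeomorph.coe_trans, Function.comp_apply] at hw ⊢
      tauto
  refine ⟨c, hman, fun i ↦ ⟨fun z hz ↦ ?_, fun w hw ↦ ?_⟩⟩
  -- Near `z`, `φ i` is a chart of `T` followed by the inverse of a chart of `M`; the inverse of `φ
  -- i` is treated in the same way.
  · have hc : φ i ≫ₕ chartAt A (φ i z) ∈ IsManifold.maximalAtlas I n T :=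
      IsManifold.subset_maximalAtlas ⟨i, _, rfl⟩
    have h1 := contMDiffOn_of_mem_maximalAtlas hc
    have h2 : ContMDiffOn I I n (chartAt A (φ i z)).symm (chartAt A (φ i z)).target :=
      contMDiffOn_chart_symm
    have h3 := h2.comp h1 fun w hw ↦ by
      simp only [OpenPartialHomeomorph.trans_source, mem_inter_iff, mem_preimage] at hw
      simpa using (chartAt A (φ i z)).map_source hw.2
    refine ((h3.congr fun w hw ↦ ?_).contMDiffAt ((φ i ≫ₕ chartAt A (φ i z)).open_source.mem_nhds
      (by simp [hz]))).contMDiffWithinAt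
    simp only [OpenPartialHomeomorph.trans_source, mem_inter_iff, mem_preimage] at hw
    simp [(chartAt A (φ i z)).left_inv hw.2]
  · have hc : φ i ≫ₕ chartAt A w ∈ IsManifold.maximalAtlas I n T :=
      IsManifold.subset_maximalAtlas ⟨i, _, rfl⟩
    have h1 := contMDiffOn_symm_of_mem_maximalAtlas hc
    have h2 : ContMDiffOn I I n (chartAt A w) (chartAt A w).source := contMDiffOn_chart
    have hopen : IsOpen ((chartAt A w).source ∩ (φ i).target) :=
      (chartAt A w).open_source.inter (φ i).open_target
    have h3 := h1.comp (h2.mono (inter_subset_left (t := (φ i).target))) fun y hy ↦ by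
      simp [(chartAt A w).left_inv hy.1, hy.2, (chartAt A w).map_source hy.1]
    refine ((h3.congr fun y hy ↦ ?_).contMDiffAt (hopen.mem_nhds ⟨mem_chart_source A w, hw⟩))
      |>.contMDiffWithinAt
    simp [(chartAt A w).left_inv hy.1]

end GeneralManifolds

/-! ### Local models for the slice inclusion and the quotient map -/

section SliceAndProjection

variable {𝕜 : Type*} [NontriviallyNormedField 𝕜] {n : ℕ∞ω}
  {VX : Type*} [NormedAddCommGroup VX] [NormedSpace 𝕜 VX]
  {VQ : Type*} [NormedAddCommGroup VQ] [NormedSpace 𝕜 VQ]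
  {VH : Type*} [NormedAddCommGroup VH] [NormedSpace 𝕜 VH]
  {VG : Type*} [NormedAddCommGroup VG] [NormedSpace 𝕜 VG]
  {F : Type*} [NormedAddCommGroup F] [NormedSpace 𝕜 F]
  {X : Type*} [TopologicalSpace X] [ChartedSpace VX X] [IsManifold 𝓘(𝕜, VX) n X]
  {Q : Type*} [TopologicalSpace Q] [ChartedSpace VQ Q] [IsManifold 𝓘(𝕜, VQ) n Q]
  {H : Type*} [TopologicalSpace H] [ChartedSpace VH H] [IsManifold 𝓘(𝕜, VH) n H]
  {G : Type*} [TopologicalSpace G] [ChartedSpace VG G] [IsManifold 𝓘(𝕜, VG) n G]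

variable (𝕜 VX VH VQ) in
/-- Exchange of the last two factors of a triple product. -/
def ContinuousLinearEquiv.prodRightComm : ((VX × VH) × VQ) ≃L[𝕜] ((VX × VQ) × VH) :=
  (ContinuousLinearEquiv.prodAssoc 𝕜 VX VH VQ).trans
    (((ContinuousLinearEquiv.refl 𝕜 VX).prodCongr (ContinuousLinearEquiv.prodComm 𝕜 VH VQ)).trans
      (ContinuousLinearEquiv.prodAssoc 𝕜 VX VQ VH).symm)

/-- The inclusion of the slice `X × {y₀} × H` is an immersion. -/
theorem Manifold.isImmersionAtOfComplement_slice (y₀ : Q) (w : X × H) :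
    IsImmersionAtOfComplement VQ (𝓘(𝕜, VX).prod 𝓘(𝕜, VH))
      ((𝓘(𝕜, VX).prod 𝓘(𝕜, VQ)).prod 𝓘(𝕜, VH)) n
      (fun w : X × H ↦ ((w.1, y₀), w.2)) w := by
  -- The normal form of an immersion is `u ↦ (u, 0)`, so the chart at `y₀` is translated to send
  -- `y₀` to `0`.
  set τ : OpenPartialHomeomorph VQ VQ :=
    (Homeomorph.addRight (-(chartAt VQ y₀ y₀))).toOpenPartialHomeomorph
  have hτ : τ ∈ IsManifold.maximalAtlas 𝓘(𝕜, VQ) n VQ := by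
    refine OpenPartialHomeomorph.mem_maximalAtlas_of_contMDiffOn _ ?_ ?_ <;>
      refine ContMDiff.contMDiffOn ?_ <;> rw [contMDiff_iff_contDiff]
    · exact contDiff_id.add contDiff_const
    · exact contDiff_id.add contDiff_const
  have hc : chartAt VQ y₀ ≫ₕ τ ∈ IsManifold.maximalAtlas 𝓘(𝕜, VQ) n Q :=
    OpenPartialHomeomorph.trans_mem_maximalAtlas _ contMDiffOn_chart contMDiffOn_chart_symm hτ
  refine .mk_of_charts (ContinuousLinearEquiv.prodRightComm 𝕜 VX VQ VH)
    ((chartAt VX w.1).prod (chartAt VH w.2))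
    (((chartAt VX w.1).prod (chartAt VQ y₀ ≫ₕ τ)).prod (chartAt VH w.2)) ?_ ?_
    (IsManifold.mem_maximalAtlas_prod (IsManifold.chart_mem_maximalAtlas _)
      (IsManifold.chart_mem_maximalAtlas _))
    (IsManifold.mem_maximalAtlas_prod (IsManifold.mem_maximalAtlas_prod
      (IsManifold.chart_mem_maximalAtlas _) hc) (IsManifold.chart_mem_maximalAtlas _)) ?_ ?_
  · simp
  · simp [τ]
  · intro w' hw'
    simp_all [τ]
  · intro u hu
    rw [OpenPartialHomeomorph.extend_prod] at hu
    obtain ⟨hu1, hu2⟩ := hu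
    have h1 := ((chartAt VX w.1).extend 𝓘(𝕜, VX)).right_inv hu1
    have h2 := ((chartAt VH w.2).extend 𝓘(𝕜, VH)).right_inv hu2
    simp only [OpenPartialHomeomorph.extend_coe, OpenPartialHomeomorph.extend_coe_symm,
      Function.comp_apply] at h1 h2
    refine Prod.ext (Prod.ext h1 ?_) h2
    exact add_neg_cancel (chartAt VQ y₀ y₀)

/-- A submersion `f : G → Q` induces a submersion `(X × H) × G → (X × Q) × H`. -/
theorem Manifold.IsSubmersionAtOfComplement.prodRightComm {f : G → Q} {w : (X × H) × G}
    (h : IsSubmersionAtOfComplement F 𝓘(𝕜, VG) 𝓘(𝕜, VQ) n f w.2) :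
    IsSubmersionAtOfComplement F ((𝓘(𝕜, VX).prod 𝓘(𝕜, VH)).prod 𝓘(𝕜, VG))
      ((𝓘(𝕜, VX).prod 𝓘(𝕜, VQ)).prod 𝓘(𝕜, VH)) n
      (fun w : (X × H) × G ↦ ((w.1.1, f w.2), w.1.2)) w := by
  -- The normal form of `f` is used in the last factor; the linear equivalence regroups the factors
  -- so that the complement `F` comes last.
  refine .mk_of_charts
    ((((ContinuousLinearEquiv.refl 𝕜 (VX × VH)).prodCongr h.equiv).trans
      (ContinuousLinearEquiv.prodAssoc 𝕜 (VX × VH) VQ F).symm).trans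
      ((ContinuousLinearEquiv.prodRightComm 𝕜 VX VQ VH).prodCongr (.refl 𝕜 F)))
    (((chartAt VX w.1.1).prod (chartAt VH w.1.2)).prod h.domChart)
    (((chartAt VX w.1.1).prod h.codChart).prod (chartAt VH w.1.2)) ?_ ?_
    (IsManifold.mem_maximalAtlas_prod (IsManifold.mem_maximalAtlas_prod
      (IsManifold.chart_mem_maximalAtlas _) (IsManifold.chart_mem_maximalAtlas _))
      h.domChart_mem_maximalAtlas)
    (IsManifold.mem_maximalAtlas_prod (IsManifold.mem_maximalAtlas_prod
      (IsManifold.chart_mem_maximalAtlas _) h.codChart_mem_maximalAtlas)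
      (IsManifold.chart_mem_maximalAtlas _)) ?_ ?_
  · simp [h.mem_domChart_source]
  · simp [h.mem_codChart_source]
  · intro w' hw'
    have := h.source_subset_preimage_source (a := w'.2)
    simp_all
  · intro u hu
    rw [OpenPartialHomeomorph.extend_prod, OpenPartialHomeomorph.extend_prod] at hu
    obtain ⟨⟨hu1, hu2⟩, hu3⟩ := hu
    have h1 := ((chartAt VX w.1.1).extend 𝓘(𝕜, VX)).right_inv hu1
    have h2 := ((chartAt VH w.1.2).extend 𝓘(𝕜, VH)).right_inv hu2
    have h3 := h.writtenInCharts hu3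
    simp only [OpenPartialHomeomorph.extend_coe, OpenPartialHomeomorph.extend_coe_symm,
      Function.comp_apply] at h1 h2 h3
    exact Prod.ext (Prod.ext h1 h3) h2

end SliceAndProjection

/-! ### Fibres and morphisms of principal bundles -/

theorem Bundle.Trivialization.eq_of_proj_eq_of_snd_eq {B F Z : Type*} [TopologicalSpace B]
    [TopologicalSpace F] [TopologicalSpace Z] {proj : Z → B} (e : Bundle.Trivialization F proj)
    {z w : Z} (hz : z ∈ e.source) (hw : w ∈ e.source) (h : proj z = proj w)
    (h' : (e z).2 = (e w).2) : z = w := by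
  rw [← e.symm_apply_mk_proj hz, ← e.symm_apply_mk_proj hw, h, h']

namespace EquivariantPrincipalBundle

section Trivializations

variable {VK AK VM AM VS AS : Type*}
  [NormedAddCommGroup VK] [NormedSpace ℂ VK] [TopologicalSpace AK]
  [NormedAddCommGroup VM] [NormedSpace ℂ VM] [TopologicalSpace AM]
  [NormedAddCommGroup VS] [NormedSpace ℂ VS] [TopologicalSpace AS]
  {IK : ModelWithCorners ℂ VK AK} {IM : ModelWithCorners ℂ VM AM}
  {IS : ModelWithCorners ℂ VS AS}
  {K M S : Type u}
  [TopologicalSpace K] [ChartedSpace AK K] [Group K]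
  [TopologicalSpace M] [ChartedSpace AM M]
  [TopologicalSpace S] [ChartedSpace AS S] [Group S]
  {act : K → M → M}

/-- An `S`-equivariant biholomorphic local trivialization of a principal bundle. -/
structure IsHolTrivialization (E : EquivariantPrincipalBundle IK IM IS K M S act)
    (e : Bundle.Trivialization S E.proj) : Prop where
  contMDiffOn : ContMDiffOn (IM.prod IS) (IM.prod IS) ω e e.source
  contMDiffOn_symm :
    ContMDiffOn (IM.prod IS) (IM.prod IS) ω e.toOpenPartialHomeomorph.symm e.target
  map_ract : ∀ z ∈ e.source, ∀ s : S, (e (E.ract z s)).2 = (e z).2 * s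

theorem exists_isHolTrivialization (E : EquivariantPrincipalBundle IK IM IS K M S act) (x : M) :
    ∃ e : Bundle.Trivialization S E.proj, x ∈ e.baseSet ∧ E.IsHolTrivialization e :=
  let ⟨e, hx, h1, h2, h3⟩ := E.locally_trivial x
  ⟨e, hx, h1, h2, h3⟩

variable {E F : EquivariantPrincipalBundle IK IM IS K M S act}
  {e : Bundle.Trivialization S E.proj}

theorem ract_mem_source {z : E.Total} (hz : z ∈ e.source) (s : S) : E.ract z s ∈ e.source := by
  rw [e.mem_source] at hz ⊢
  rwa [E.proj_ract]

namespace IsHolTrivialization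

theorem symm_mul (he : E.IsHolTrivialization e) {x : M} (hx : x ∈ e.baseSet) (s t : S) :
    e.toOpenPartialHomeomorph.symm (x, s * t) =
      E.ract (e.toOpenPartialHomeomorph.symm (x, s)) t := by
  have h1 : e.toOpenPartialHomeomorph.symm (x, s) ∈ e.source :=
    e.map_target (e.mem_target.2 hx)
  refine e.eq_of_proj_eq_of_snd_eq (e.map_target (e.mem_target.2 hx)) (ract_mem_source h1 t) ?_ ?_
  · rw [E.proj_ract, e.proj_symm_apply' hx, e.proj_symm_apply' hx]
  · rw [he.map_ract _ h1, e.apply_symm_apply (e.mem_target.2 hx),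
      e.apply_symm_apply (e.mem_target.2 hx)]

theorem symm_eq_ract (he : E.IsHolTrivialization e) {x : M} (hx : x ∈ e.baseSet) (s : S) :
    e.toOpenPartialHomeomorph.symm (x, s) =
      E.ract (e.toOpenPartialHomeomorph.symm (x, 1)) s := by
  rw [← he.symm_mul hx, one_mul]

end IsHolTrivialization

theorem ract_injective {z : E.Total} {s t : S} (h : E.ract z s = E.ract z t) : s = t := by
  obtain ⟨e, hx, he⟩ := E.exists_isHolTrivialization (E.proj z)
  have hz : z ∈ e.source := e.mem_source.2 hx
  have := he.map_ract z hz s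
  rw [h, he.map_ract z hz t] at this
  exact (mul_left_cancel this).symm

theorem exists_ract_eq {z w : E.Total} (h : E.proj z = E.proj w) : ∃ s, E.ract z s = w := by
  obtain ⟨e, hx, he⟩ := E.exists_isHolTrivialization (E.proj z)
  have hz : z ∈ e.source := e.mem_source.2 hx
  have hw : w ∈ e.source := e.mem_source.2 (h ▸ hx)
  refine ⟨(e z).2⁻¹ * (e w).2, e.eq_of_proj_eq_of_snd_eq (ract_mem_source hz _) hw ?_ ?_⟩
  · rw [E.proj_ract, h]
  · rw [he.map_ract z hz, mul_inv_cancel_left]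

/-- On each fibre `φ` is an equivariant map between torsors under `S`, which is always bijective. -/
theorem bijective_of_equivariant {φ : E.Total → F.Total} (hproj : ∀ z, F.proj (φ z) = E.proj z)
    (hract : ∀ z s, φ (E.ract z s) = F.ract (φ z) s) : Function.Bijective φ := by
  constructor
  · intro z w hzw
    obtain ⟨s, rfl⟩ := exists_ract_eq (E := E) (z := z) (w := w)
      (by rw [← hproj, hzw, hproj])
    rw [hract] at hzw
    have : s = 1 := ract_injective (E := F) (z := φ z) (by rw [← hzw, F.ract_one])
    rw [this, E.ract_one]
  · intro w
    obtain ⟨e, hx, he⟩ := E.exists_isHolTrivialization (F.proj w)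
    obtain ⟨s, hs⟩ := exists_ract_eq (E := F)
      (z := φ (e.toOpenPartialHomeomorph.symm (F.proj w, 1))) (w := w)
      (by rw [hproj, e.proj_symm_apply' hx])
    exact ⟨E.ract (e.toOpenPartialHomeomorph.symm (F.proj w, 1)) s, by rw [hract, hs]⟩

section Morphisms

variable [LieGroup IS ω S]

/-- The inverse of a holomorphic morphism of principal bundles is holomorphic. -/
theorem contMDiff_of_rightInverse {φ : E.Total → F.Total}
    (hφ : ContMDiff (IM.prod IS) (IM.prod IS) ω φ) (hproj : ∀ z, F.proj (φ z) = E.proj z)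
    (hract : ∀ z s, φ (E.ract z s) = F.ract (φ z) s) {ψ : F.Total → E.Total}
    (hψ : ∀ w, φ (ψ w) = w) : ContMDiff (IM.prod IS) (IM.prod IS) ω ψ := by
  intro w₀
  obtain ⟨e, hx, he⟩ := E.exists_isHolTrivialization (F.proj w₀)
  obtain ⟨f, hy, hf⟩ := F.exists_isHolTrivialization (F.proj w₀)
  set U : Set F.Total := F.proj ⁻¹' (e.baseSet ∩ f.baseSet)
  have hU : IsOpen U := (e.open_baseSet.inter f.open_baseSet).preimage F.contMDiff_proj.continuous
  have hfU : ContMDiffOn (IM.prod IS) (IM.prod IS) ω f U :=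
    hf.contMDiffOn.mono fun w hw ↦ f.mem_source.2 hw.2
  have hσ : ContMDiffOn (IM.prod IS) (IM.prod IS) ω
      (fun w ↦ e.toOpenPartialHomeomorph.symm (F.proj w, 1)) U :=
    he.contMDiffOn_symm.comp (F.contMDiff_proj.contMDiffOn.prodMk contMDiffOn_const)
      fun w hw ↦ e.mem_target.2 hw.1
  -- In the trivializations `φ` is `(x, s) ↦ (x, c(x) s)`; this is `c`. The inverse is then `(x, s)
  -- ↦ (x, c(x)⁻¹ s)`, holomorphic because `S` is a Lie group.
  have hc : ContMDiffOn (IM.prod IS) IS ω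
      (fun w ↦ (f (φ (e.toOpenPartialHomeomorph.symm (F.proj w, 1)))).2) U :=
    contMDiff_snd.comp_contMDiffOn (hf.contMDiffOn.comp (hφ.comp_contMDiffOn hσ) fun w hw ↦ by
      rw [mem_preimage, f.mem_source, hproj, e.proj_symm_apply' hw.1]
      exact hw.2)
  have hψU : ContMDiffOn (IM.prod IS) (IM.prod IS) ω
      (fun w ↦ e.toOpenPartialHomeomorph.symm (F.proj w,
        (f (φ (e.toOpenPartialHomeomorph.symm (F.proj w, 1)))).2⁻¹ * (f w).2)) U :=
    he.contMDiffOn_symm.comp (F.contMDiff_proj.contMDiffOn.prodMk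
      (hc.inv.mul (contMDiff_snd.comp_contMDiffOn hfU))) fun w hw ↦ e.mem_target.2 hw.1
  refine (hψU.congr fun w hw ↦ ?_).contMDiffAt (hU.mem_nhds ⟨hx, hy⟩)
  -- `ψ` is known only through `φ ∘ ψ = id`, so the local formula is tested after applying the
  -- injective `φ`.
  refine (bijective_of_equivariant hproj hract).1 ?_
  rw [hψ, he.symm_eq_ract hw.1, hract]
  set z := e.toOpenPartialHomeomorph.symm (F.proj w, 1)
  have hz : F.proj (φ z) = F.proj w := by rw [hproj, e.proj_symm_apply' hw.1]
  have hzf : φ z ∈ f.source := f.mem_source.2 (hz ▸ hw.2)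
  refine f.eq_of_proj_eq_of_snd_eq (f.mem_source.2 hw.2) (ract_mem_source hzf _) ?_ ?_
  · rw [F.proj_ract, hz]
  · rw [hf.map_ract _ hzf, mul_inv_cancel_left]

/-- A holomorphic equivariant map of principal bundles over the identity is an isomorphism. -/
noncomputable def homOfContMDiff (φ : E.Total → F.Total)
    (hφ : ContMDiff (IM.prod IS) (IM.prod IS) ω φ) (hproj : ∀ z, F.proj (φ z) = E.proj z)
    (hract : ∀ z s, φ (E.ract z s) = F.ract (φ z) s)
    (hlact : ∀ k z, φ (E.lact k z) = F.lact k (φ z)) : E ⟶ F where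
  toDiffeomorph :=
    { toEquiv := Equiv.ofBijective φ (bijective_of_equivariant hproj hract)
      contMDiff_toFun := hφ
      contMDiff_invFun := contMDiff_of_rightInverse hφ hproj hract
        (Equiv.ofBijective φ (bijective_of_equivariant hproj hract)).apply_symm_apply }
  proj_map := hproj
  map_ract := hract
  map_lact := hlact

end Morphisms

theorem hom_ext {f g : E ⟶ F} (h : ∀ z, mapTotal f z = mapTotal g z) : f = g :=
  Hom.ext (Diffeomorph.ext h)

theorem contMDiff_mapTotal (f : E ⟶ F) :
    ContMDiff (IM.prod IS) (IM.prod IS) ω (mapTotal f) :=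
  (Hom.toDiffeomorph f).contMDiff

theorem proj_mapTotal (f : E ⟶ F) (z : E.Total) : F.proj (mapTotal f z) = E.proj z :=
  Hom.proj_map f z

theorem mapTotal_ract (f : E ⟶ F) (z : E.Total) (s : S) :
    mapTotal f (E.ract z s) = F.ract (mapTotal f z) s :=
  Hom.map_ract f z s

theorem mapTotal_lact (f : E ⟶ F) (k : K) (z : E.Total) :
    mapTotal f (E.lact k z) = F.lact k (mapTotal f z) :=
  Hom.map_lact f k z

@[simp]
theorem mapTotal_id (z : E.Total) : mapTotal (𝟙 E) z = z := rfl

@[simp]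
theorem mapTotal_comp {D : EquivariantPrincipalBundle IK IM IS K M S act} (f : D ⟶ E) (g : E ⟶ F)
    (z : D.Total) : mapTotal (f ≫ g) z = mapTotal g (mapTotal f z) := rfl

theorem mapTotal_inv_mapTotal (f : E ≅ F) (z : E.Total) :
    mapTotal f.inv (mapTotal f.hom z) = z := by
  rw [← mapTotal_comp, f.hom_inv_id, mapTotal_id]

end Trivializations

end EquivariantPrincipalBundle

/-! ### The equivalence of groupoids, given existence of restrictions and inductions -/

section Equivalence

open EquivariantPrincipalBundle

variable {VX VG VP VQ VH : Type*}
  [NormedAddCommGroup VX] [NormedSpace ℂ VX]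
  [NormedAddCommGroup VG] [NormedSpace ℂ VG]
  [NormedAddCommGroup VP] [NormedSpace ℂ VP]
  [NormedAddCommGroup VQ] [NormedSpace ℂ VQ]
  [NormedAddCommGroup VH] [NormedSpace ℂ VH]
  {X : Type u} [TopologicalSpace X] [ChartedSpace VX X]
  {G : Type u} [TopologicalSpace G] [ChartedSpace VG G] [Group G]
  {P : Subgroup G} [ChartedSpace VP P] [ChartedSpace VQ (G ⧸ P)]
  {H : Type u} [TopologicalSpace H] [ChartedSpace VH H] [Group H]

namespace IsSliceRestriction

variable {E' : BunProductFlag VX VG VQ VH X P H} {E : BunTrivialAction VX VP VH X P H}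
  {j : E.Total → E'.Total}

theorem injective (hj : IsSliceRestriction E' E j) : Function.Injective j :=
  hj.isSmoothEmbedding.isEmbedding.injective

theorem exists_eq (hj : IsSliceRestriction E' E j) {z : E'.Total}
    (hz : (E'.proj z).2 = ((1 : G) : G ⧸ P)) : ∃ e, j e = z := by
  have : z ∈ range j := by rw [hj.range_eq]; exact hz
  exact this

theorem contMDiff (hj : IsSliceRestriction E' E j) :
    ContMDiff (𝓘(ℂ, VX).prod 𝓘(ℂ, VH)) ((𝓘(ℂ, VX).prod 𝓘(ℂ, VQ)).prod 𝓘(ℂ, VH)) ω j :=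
  hj.isSmoothEmbedding.contMDiff

/-- A morphism of `P`-equivariant bundles into a restriction, given by its composition with the
inclusion of the slice. -/
theorem exists_hom [LieGroup 𝓘(ℂ, VH) ω H] (hj : IsSliceRestriction E' E j)
    {D : BunTrivialAction VX VP VH X P H} (φ : D.Total → E'.Total)
    (hφ : ContMDiff (𝓘(ℂ, VX).prod 𝓘(ℂ, VH)) ((𝓘(ℂ, VX).prod 𝓘(ℂ, VQ)).prod 𝓘(ℂ, VH)) ω φ)
    (hproj : ∀ e, E'.proj (φ e) = (D.proj e, ((1 : G) : G ⧸ P)))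
    (hract : ∀ e h, φ (D.ract e h) = E'.ract (φ e) h)
    (hlact : ∀ (p : P) e, φ (D.lact p e) = E'.lact (p : G) (φ e)) :
    ∃ f : D ⟶ E, ∀ e, j (mapTotal f e) = φ e := by
  choose ψ hψ using fun e ↦ hj.exists_eq (z := φ e) (by rw [hproj])
  refine ⟨homOfContMDiff ψ (hj.isSmoothEmbedding.contMDiff_of_comp ?_) ?_ ?_ ?_, hψ⟩
  · rwa [show j ∘ ψ = φ from funext hψ]
  · intro e
    have := hj.proj_map (ψ e)
    rw [hψ, hproj] at this
    exact (congrArg Prod.fst this).symm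
  · intro e h
    exact hj.injective (by rw [hψ, hract, hj.map_ract, hψ])
  · intro p e
    exact hj.injective (by rw [hψ, hlact, hj.map_lact, hψ])

end IsSliceRestriction

namespace IsInduction

variable {E : BunTrivialAction VX VP VH X P H} {E' : BunProductFlag VX VG VQ VH X P H}
  {q : E.Total × G → E'.Total}

theorem contMDiff (hq : IsInduction E E' q) :
    ContMDiff ((𝓘(ℂ, VX).prod 𝓘(ℂ, VH)).prod 𝓘(ℂ, VG))
      ((𝓘(ℂ, VX).prod 𝓘(ℂ, VQ)).prod 𝓘(ℂ, VH)) ω q :=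
  hq.isSubmersion.contMDiff

/-- The balanced form of `eq_iff`: elements of `P` pass between the two factors, as in `G ×ᴾ E`. -/
theorem apply_lact (hq : IsInduction E E' q) (p : P) (e : E.Total) (g : G) :
    q (E.lact p e, g) = q (e, g * p) :=
  ((hq.eq_iff _ _ _ _).2 ⟨p, rfl, by simp⟩).symm

/-- A morphism of `G`-equivariant bundles out of an induced bundle, given by its composition with
the quotient map. -/
theorem exists_hom [LieGroup 𝓘(ℂ, VH) ω H] (hq : IsInduction E E' q)
    {D : BunProductFlag VX VG VQ VH X P H} (φ : E.Total × G → D.Total)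
    (hφ : ContMDiff ((𝓘(ℂ, VX).prod 𝓘(ℂ, VH)).prod 𝓘(ℂ, VG))
      ((𝓘(ℂ, VX).prod 𝓘(ℂ, VQ)).prod 𝓘(ℂ, VH)) ω φ)
    (hinv : ∀ (p : P) e g, φ (E.lact p e, g) = φ (e, g * p))
    (hproj : ∀ e g, D.proj (φ (e, g)) = (E.proj e, (g : G ⧸ P)))
    (hract : ∀ e g h, φ (E.ract e h, g) = D.ract (φ (e, g)) h)
    (hlact : ∀ g' e g, φ (e, g' * g) = D.lact g' (φ (e, g))) :
    ∃ f : E' ⟶ D, ∀ e g, mapTotal f (q (e, g)) = φ (e, g) := by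
  -- The representative is arbitrary; `hψ` shows by `hinv` that the value does not depend on it.
  set ψ : E'.Total → D.Total := fun t ↦ φ (Function.surjInv hq.surjective t)
  have hψ : ∀ e g, ψ (q (e, g)) = φ (e, g) := by
    intro e g
    have hs := Function.surjInv_eq hq.surjective (q (e, g))
    change φ (Function.surjInv hq.surjective (q (e, g))) = _
    generalize Function.surjInv hq.surjective (q (e, g)) = w at hs
    obtain ⟨p, hp1, hp2⟩ := (hq.eq_iff e g w.1 w.2).1 hs.symm
    rw [← Prod.mk.eta (p := w), hp1, hp2, hinv, inv_mul_cancel_right]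
  have hforall : ∀ {C : E'.Total → Prop}, (∀ e g, C (q (e, g))) → ∀ t, C t := fun h t ↦ by
    obtain ⟨⟨e, g⟩, rfl⟩ := hq.surjective t
    exact h e g
  refine ⟨homOfContMDiff ψ (hq.isSubmersion.contMDiff_of_comp hq.surjective ?_)
    (hforall fun e g ↦ ?_) (hforall fun e g h ↦ ?_) (fun g' ↦ hforall fun e g ↦ ?_), hψ⟩
  · rwa [show ψ ∘ q = φ from funext fun w ↦ hψ w.1 w.2]
  · rw [hψ, hproj, hq.proj_map]
  · rw [← hq.map_ract, hψ, hψ, hract]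
  · rw [← hq.map_lact, hψ, hψ, hlact]

theorem hom_ext (hq : IsInduction E E' q) {D : BunProductFlag VX VG VQ VH X P H} {f f' : E' ⟶ D}
    (h : ∀ e g, mapTotal f (q (e, g)) = mapTotal f' (q (e, g))) : f = f' := by
  refine EquivariantPrincipalBundle.hom_ext fun t ↦ ?_
  obtain ⟨⟨e, g⟩, rfl⟩ := hq.surjective t
  exact h e g

end IsInduction

theorem IsSliceRestriction.hom_ext {E' : BunProductFlag VX VG VQ VH X P H}
    {E D : BunTrivialAction VX VP VH X P H} {j : E.Total → E'.Total}
    (hj : IsSliceRestriction E' E j) {f f' : D ⟶ E}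
    (h : ∀ e, j (mapTotal f e) = j (mapTotal f' e)) : f = f' :=
  EquivariantPrincipalBundle.hom_ext fun e ↦ hj.injective (h e)

/-- Restriction to the slice and induction are mutually quasi-inverse as soon as every bundle has a
restriction and an induced bundle. -/
theorem exists_equivalence_of_isSliceRestriction_of_isInduction [LieGroup 𝓘(ℂ, VH) ω H]
    (hres : ∀ E' : BunProductFlag VX VG VQ VH X P H, ∃ (E : BunTrivialAction VX VP VH X P H)
      (j : E.Total → E'.Total), IsSliceRestriction E' E j)
    (hind : ∀ E : BunTrivialAction VX VP VH X P H, ∃ (E' : BunProductFlag VX VG VQ VH X P H)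
      (q : E.Total × G → E'.Total), IsInduction E E' q) :
    ∃ (Φ : BunProductFlag VX VG VQ VH X P H ≌ BunTrivialAction VX VP VH X P H)
      (j : ∀ E' : BunProductFlag VX VG VQ VH X P H, (Φ.functor.obj E').Total → E'.Total)
      (q : ∀ E : BunTrivialAction VX VP VH X P H, E.Total × G → (Φ.inverse.obj E).Total),
      (∀ E', IsSliceRestriction E' (Φ.functor.obj E') (j E')) ∧
      (∀ E, IsInduction E (Φ.inverse.obj E) (q E)) ∧
      (∀ (E' F' : BunProductFlag VX VG VQ VH X P H) (f : E' ⟶ F') (e : (Φ.functor.obj E').Total),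
        j F' (mapTotal (Φ.functor.map f) e) = mapTotal f (j E' e)) ∧
      (∀ (E F : BunTrivialAction VX VP VH X P H) (f : E ⟶ F) (e : E.Total) (g : G),
        q F (mapTotal f e, g) = mapTotal (Φ.inverse.map f) (q E (e, g))) ∧
      (∀ (E' : BunProductFlag VX VG VQ VH X P H) (e : (Φ.functor.obj E').Total) (g : G),
        mapTotal (Φ.unitIso.hom.app E') (E'.lact g (j E' e)) = q (Φ.functor.obj E') (e, g)) ∧
      (∀ (E : BunTrivialAction VX VP VH X P H) (e : E.Total),
        j (Φ.inverse.obj E) (mapTotal (Φ.counitIso.inv.app E) e) = q E (e, 1)) := by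
  choose R j hj using hres
  choose I q hq using hind
  have hR : ∀ {E' F' : BunProductFlag VX VG VQ VH X P H} (f : E' ⟶ F'),
      ∃ r : R E' ⟶ R F', ∀ e, j F' (mapTotal r e) = mapTotal f (j E' e) := fun {E' F'} f ↦
    (hj F').exists_hom (fun e ↦ mapTotal f (j E' e)) ((contMDiff_mapTotal f).comp (hj E').contMDiff)
      (fun e ↦ by rw [proj_mapTotal, (hj E').proj_map])
      (fun e h ↦ by rw [(hj E').map_ract, mapTotal_ract])
      (fun p e ↦ by rw [(hj E').map_lact, mapTotal_lact])
  choose Rmap hRmap using @hR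
  have hI : ∀ {E F : BunTrivialAction VX VP VH X P H} (f : E ⟶ F),
      ∃ r : I E ⟶ I F, ∀ e g, mapTotal r (q E (e, g)) = q F (mapTotal f e, g) := fun {E F} f ↦
    (hq E).exists_hom (fun w ↦ q F (mapTotal f w.1, w.2))
      ((hq F).contMDiff.comp (((contMDiff_mapTotal f).comp contMDiff_fst).prodMk contMDiff_snd))
      (fun p e g ↦ by simp only [mapTotal_lact, (hq F).apply_lact])
      (fun e g ↦ by simp only [(hq F).proj_map, proj_mapTotal])
      (fun e g h ↦ by simp only [mapTotal_ract, (hq F).map_ract])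
      (fun g' e g ↦ by simp only [(hq F).map_lact])
  choose Imap hImap using @hI
  let Res : BunProductFlag VX VG VQ VH X P H ⥤ BunTrivialAction VX VP VH X P H :=
    { obj := R
      map := Rmap
      map_id := fun E' ↦ (hj E').hom_ext fun e ↦ by simp [hRmap]
      map_comp := fun f g ↦ (hj _).hom_ext fun e ↦ by simp [hRmap] }
  let Ind : BunTrivialAction VX VP VH X P H ⥤ BunProductFlag VX VG VQ VH X P H :=
    { obj := I
      map := Imap
      map_id := fun E ↦ (hq E).hom_ext fun e g ↦ by simp [hImap]
      map_comp := fun f g ↦ (hq _).hom_ext fun e g ↦ by simp [hImap] }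
  -- The action map `(e, g) ↦ g · j(e)` is constant on `P`-orbits because `j` is `P`-equivariant, so
  -- it descends to the induced bundle.
  have ha : ∀ E' : BunProductFlag VX VG VQ VH X P H, ∃ a : I (R E') ⟶ E',
      ∀ e g, mapTotal a (q (R E') (e, g)) = E'.lact g (j E' e) := fun E' ↦
    (hq (R E')).exists_hom (fun w ↦ E'.lact w.2 (j E' w.1))
      (E'.contMDiff_lact.comp (contMDiff_snd.prodMk ((hj E').contMDiff.comp contMDiff_fst)))
      (fun p e g ↦ by simp only [(hj E').map_lact, E'.lact_mul])
      (fun e g ↦ by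
        simp only [E'.proj_lact, (hj E').proj_map, MulAction.Quotient.smul_coe, smul_eq_mul,
          mul_one])
      (fun e g h ↦ by simp only [(hj E').map_ract, E'.lact_ract])
      (fun g' e g ↦ by simp only [E'.lact_mul])
  choose a ha using ha
  have hb : ∀ E : BunTrivialAction VX VP VH X P H, ∃ b : E ⟶ R (I E),
      ∀ e, j (I E) (mapTotal b e) = q E (e, 1) := fun E ↦
    (hj (I E)).exists_hom (fun e ↦ q E (e, 1))
      ((hq E).contMDiff.comp (contMDiff_id.prodMk contMDiff_const))
      (fun e ↦ by rw [(hq E).proj_map])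
      (fun e h ↦ by rw [(hq E).map_ract])
      (fun p e ↦ by rw [(hq E).apply_lact, one_mul, ← (hq E).map_lact, mul_one])
  choose b hb using hb
  -- In a groupoid `a E'` is already invertible, so only naturality has to be checked.
  let ηinv : Res ⋙ Ind ≅ 𝟭 _ := NatIso.ofComponents
    (fun E' ↦ (Groupoid.isoEquivHom (I (R E')) E').symm (a E'))
    (fun {E' F'} f ↦ (hq (R E')).hom_ext fun e g ↦ by
      change mapTotal (a F') (mapTotal (Imap (Rmap f)) _) = mapTotal f (mapTotal (a E') _)
      rw [hImap, ha, ha, hRmap, mapTotal_lact])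
  let εinv : 𝟭 _ ≅ Ind ⋙ Res := NatIso.ofComponents
    (fun E ↦ (Groupoid.isoEquivHom E (R (I E))).symm (b E))
    (fun {E F} f ↦ (hj (I F)).hom_ext fun e ↦ by
      change j (I F) (mapTotal (b F) (mapTotal f e)) =
        j (I F) (mapTotal (Rmap (Imap f)) (mapTotal (b E) e))
      rw [hb, hRmap, hb, hImap])
  have hη : ∀ E' e g, mapTotal (ηinv.inv.app E') (E'.lact g (j E' e)) = q (R E') (e, g) := by
    intro E' e g
    rw [← ha]
    exact mapTotal_inv_mapTotal (ηinv.app E') _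
  refine ⟨{ functor := Res, inverse := Ind, unitIso := ηinv.symm, counitIso := εinv.symm,
            functor_unitIso_comp := fun E' ↦ ?_ }, j, q, hj, hq, fun _ _ f ↦ hRmap f,
    fun _ _ f e g ↦ (hImap f e g).symm, hη, hb⟩
  -- Triangle identity: after `j`, both sides send `e` to `q (e, 1)`.
  have : Res.map (ηinv.symm.hom.app E') = εinv.hom.app (Res.obj E') :=
    (hj (I (R E'))).hom_ext fun e ↦ by
      refine (hRmap (ηinv.inv.app E') e).trans ?_
      have h1 := hη E' e 1
      rw [E'.lact_one] at h1
      exact h1.trans (hb (R E') e).symm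
  rw [this]
  exact εinv.hom_inv_id_app (Res.obj E')

end Equivalence

/-! ### Restriction to the slice -/

/-- The restriction of a local trivialization of a bundle over `B × B'` to the slice over
`B × {y₀}`. -/
noncomputable def Bundle.Trivialization.slice {B B' F Z : Type*} [TopologicalSpace B]
    [TopologicalSpace B'] [TopologicalSpace F] [TopologicalSpace Z] {proj : Z → B × B'}
    (e : Bundle.Trivialization F proj) {y₀ : B'} (z₀ : {z // (proj z).2 = y₀}) :
    Bundle.Trivialization F (fun z : {z // (proj z).2 = y₀} ↦ (proj z.1).1) where
  toFun z := ((e z.1).1.1, (e z.1).2)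
  -- The inverse must be total although the slice could be empty; `z₀` is the default value off the
  -- base set.
  invFun w := by
    classical
    exact if h : (w.1, y₀) ∈ e.baseSet then
      ⟨e.toOpenPartialHomeomorph.symm ((w.1, y₀), w.2), by rw [e.proj_symm_apply' h]⟩ else z₀
  source := {z | z.1 ∈ e.source}
  target := {x | (x, y₀) ∈ e.baseSet} ×ˢ univ
  baseSet := {x | (x, y₀) ∈ e.baseSet}
  open_baseSet := e.open_baseSet.preimage (by fun_prop)
  open_source := e.open_source.preimage continuous_subtype_val
  open_target := (e.open_baseSet.preimage (by fun_prop)).prod isOpen_univ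
  source_eq := by
    ext ⟨z, rfl⟩
    simp [e.mem_source]
  target_eq := rfl
  proj_toFun z hz := congrArg Prod.fst (e.coe_fst hz)
  map_source' := by
    rintro ⟨z, rfl⟩ hz
    refine ⟨?_, trivial⟩
    simp only [mem_ofPred_eq, e.coe_fst hz]
    exact e.mem_source.1 hz
  map_target' w hw := by
    have hw' : (w.1, y₀) ∈ e.baseSet := hw.1
    simp only [dif_pos hw', mem_ofPred_eq]
    exact e.map_target (e.mem_target.2 hw')
  left_inv' := by
    rintro ⟨z, rfl⟩ hz
    have hz' : ((e z).1.1, (proj z).2) ∈ e.baseSet := by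
      rw [e.coe_fst hz]; exact e.mem_source.1 hz
    simp only [dif_pos hz']
    refine Subtype.ext ?_
    simp only [e.coe_fst hz]
    exact e.symm_apply_mk_proj hz
  right_inv' w hw := by
    have hw' : (w.1, y₀) ∈ e.baseSet := hw.1
    simp only [dif_pos hw']
    rw [e.apply_symm_apply (e.mem_target.2 hw')]
  continuousOn_toFun := by
    have : ContinuousOn (fun z : {z // (proj z).2 = y₀} ↦ e z.1) {z | z.1 ∈ e.source} :=
      e.continuousOn_toFun.comp continuous_subtype_val.continuousOn fun _ h ↦ h
    exact (continuous_fst.comp_continuousOn (continuous_fst.comp_continuousOn this)).prodMk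
      (continuous_snd.comp_continuousOn this)
  continuousOn_invFun := by
    refine (IsEmbedding.subtypeVal (p := fun z ↦ (proj z).2 = y₀)).isInducing.continuousOn_iff.2 ?_
    have : ContinuousOn (fun w : B × F ↦ e.toOpenPartialHomeomorph.symm ((w.1, y₀), w.2))
        ({x | (x, y₀) ∈ e.baseSet} ×ˢ univ) :=
      e.toOpenPartialHomeomorph.continuousOn_symm.comp (by fun_prop)
        fun w hw ↦ e.mem_target.2 hw.1
    refine this.congr fun w hw ↦ ?_
    have hw' : (w.1, y₀) ∈ e.baseSet := hw.1
    simp only [Function.comp_apply, dif_pos hw']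

section Slice

variable {B B' F Z : Type*} [TopologicalSpace B]
    [TopologicalSpace B'] [TopologicalSpace F] [TopologicalSpace Z] {proj : Z → B × B'}
    (e : Bundle.Trivialization F proj) {y₀ : B'} (z₀ : {z // (proj z).2 = y₀})

theorem Bundle.Trivialization.slice_apply (z : {z // (proj z).2 = y₀}) :
    e.slice z₀ z = ((e z.1).1.1, (e z.1).2) := rfl

theorem Bundle.Trivialization.slice_symm_apply {w : B × F} (hw : (w.1, y₀) ∈ e.baseSet) :
    ((e.slice z₀).toOpenPartialHomeomorph.symm w).1 =
      e.toOpenPartialHomeomorph.symm ((w.1, y₀), w.2) := by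
  change ((e.slice z₀).invFun w).1 = _
  simp only [Bundle.Trivialization.slice, dif_pos hw]

end Slice

section Restriction

open EquivariantPrincipalBundle

variable {VX VG VP VQ VH : Type*}
  [NormedAddCommGroup VX] [NormedSpace ℂ VX]
  [NormedAddCommGroup VG] [NormedSpace ℂ VG]
  [NormedAddCommGroup VP] [NormedSpace ℂ VP]
  [NormedAddCommGroup VQ] [NormedSpace ℂ VQ]
  [NormedAddCommGroup VH] [NormedSpace ℂ VH]
  {X : Type u} [TopologicalSpace X] [ChartedSpace VX X] [IsManifold 𝓘(ℂ, VX) ω X]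
  {G : Type u} [TopologicalSpace G] [ChartedSpace VG G] [Group G]
  {P : Subgroup G} [ChartedSpace VP P]
  [ChartedSpace VQ (G ⧸ P)] [IsManifold 𝓘(ℂ, VQ) ω (G ⧸ P)]
  {H : Type u} [TopologicalSpace H] [ChartedSpace VH H] [Group H] [LieGroup 𝓘(ℂ, VH) ω H]

/-- Every `G`-equivariant bundle on `X × G/P` has a restriction to the slice `X × {o}`. -/
theorem exists_isSliceRestriction
    (hι : ContMDiff 𝓘(ℂ, VP) 𝓘(ℂ, VG) ω (Subtype.val : P → G))
    (E' : BunProductFlag VX VG VQ VH X P H) :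
    ∃ (E : BunTrivialAction VX VP VH X P H) (j : E.Total → E'.Total),
      IsSliceRestriction E' E j := by
  set o : G ⧸ P := ((1 : G) : G ⧸ P)
  let T := {z : E'.Total // (E'.proj z).2 = o}
  -- Each holomorphic trivialization is paired with a point of `T`, the default value that `slice`
  -- needs.
  let ι := {e : Bundle.Trivialization H E'.proj // E'.IsHolTrivialization e} × T
  let φ (i : ι) := i.1.1.slice i.2
  have hslice : ContMDiff (𝓘(ℂ, VX).prod 𝓘(ℂ, VH)) ((𝓘(ℂ, VX).prod 𝓘(ℂ, VQ)).prod 𝓘(ℂ, VH)) ω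
      (fun w : X × H ↦ ((w.1, o), w.2)) :=
    (contMDiff_fst.prodMk contMDiff_const).prodMk contMDiff_snd
  have hcov : ∀ x : X, ∃ i, x ∈ (φ i).baseSet := by
    intro x
    obtain ⟨e, hx, he⟩ := E'.exists_isHolTrivialization (x, o)
    exact ⟨⟨⟨e, he⟩, ⟨e.toOpenPartialHomeomorph.symm ((x, o), 1),
      by rw [e.proj_symm_apply' hx]⟩⟩, hx⟩
  obtain ⟨c, hT, hφ⟩ := exists_chartedSpace_of_compatible (I := 𝓘(ℂ, VX).prod 𝓘(ℂ, VH))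
    (n := ω) (fun i ↦ (φ i).toOpenPartialHomeomorph)
    (fun z ↦ by
      obtain ⟨i, hi⟩ := hcov (E'.proj z.1).1
      exact ⟨i, (φ i).mem_source.2 hi⟩)
    (fun i k ↦ by
      set W := ((φ i).toOpenPartialHomeomorph.symm ≫ₕ (φ k).toOpenPartialHomeomorph).source
      have hW : ∀ w ∈ W, (w.1, o) ∈ i.1.1.baseSet := fun w hw ↦ hw.1.1
      -- The transition map is that of `E'`, preceded by `(x, h) ↦ ((x, o), h)` and followed by
      -- dropping the `G/P`-coordinate.
      have h1 : ContMDiffOn (𝓘(ℂ, VX).prod 𝓘(ℂ, VH)) ((𝓘(ℂ, VX).prod 𝓘(ℂ, VQ)).prod 𝓘(ℂ, VH)) ω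
          (fun w : X × H ↦ i.1.1.toOpenPartialHomeomorph.symm ((w.1, o), w.2)) W :=
        i.1.2.contMDiffOn_symm.comp hslice.contMDiffOn fun w hw ↦ i.1.1.mem_target.2 (hW w hw)
      have h2 := k.1.2.contMDiffOn.comp h1 fun w hw ↦ by
        have hw' : ((φ i).toOpenPartialHomeomorph.symm w).1 ∈ k.1.1.source := hw.2
        rwa [Bundle.Trivialization.slice_symm_apply _ _ (hW w hw)] at hw'
      have h3 : ContMDiff ((𝓘(ℂ, VX).prod 𝓘(ℂ, VQ)).prod 𝓘(ℂ, VH)) (𝓘(ℂ, VX).prod 𝓘(ℂ, VH)) ω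
          (fun w : (X × G ⧸ P) × H ↦ (w.1.1, w.2)) :=
        (contMDiff_fst.comp contMDiff_fst).prodMk contMDiff_snd
      refine (h3.comp_contMDiffOn h2).congr fun w hw ↦ ?_
      change (φ k) ((φ i).toOpenPartialHomeomorph.symm w) = _
      rw [Bundle.Trivialization.slice_apply,
        Bundle.Trivialization.slice_symm_apply _ _ (hW w hw)]
      rfl)
  have hemb : IsSmoothEmbedding (𝓘(ℂ, VX).prod 𝓘(ℂ, VH))
      ((𝓘(ℂ, VX).prod 𝓘(ℂ, VQ)).prod 𝓘(ℂ, VH)) ω (Subtype.val : T → E'.Total) := by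
    refine ⟨IsImmersionOfComplement.isImmersion (F := VQ) fun z ↦ ?_, IsEmbedding.subtypeVal⟩
    obtain ⟨i, hi⟩ := hcov (E'.proj z.1).1
    -- In a trivialization of `E'` and its slice, the inclusion `T → E'` becomes `(x, h) ↦ ((x, o),
    -- h)`.
    refine IsImmersionAtOfComplement.of_conj (φ i).toOpenPartialHomeomorph (hφ i).1 (hφ i).2
      i.1.1.toOpenPartialHomeomorph i.1.2.contMDiffOn i.1.2.contMDiffOn_symm
      (fun y hy ↦ hy) (fun y hy ↦ ?_) ((φ i).mem_source.2 hi)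
      (isImmersionAtOfComplement_slice o _)
    have h1 : (i.1.1 y.1).1 = E'.proj y.1 := i.1.1.coe_fst hy
    exact Prod.ext (Prod.ext rfl ((congrArg Prod.snd h1).trans y.2)) rfl
  refine ⟨{
    Total := T
    proj := fun z ↦ (E'.proj z.1).1
    contMDiff_proj := contMDiff_fst.comp (E'.contMDiff_proj.comp hemb.contMDiff)
    ract := fun z h ↦ ⟨E'.ract z.1 h, by rw [E'.proj_ract, z.2]⟩
    ract_one := fun z ↦ Subtype.ext (E'.ract_one _)
    ract_mul := fun z s t ↦ Subtype.ext (E'.ract_mul _ _ _)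
    proj_ract := fun z s ↦ by rw [E'.proj_ract]
    -- The actions on `T` are holomorphic because they are so in `E'`, into which `T` embeds.
    contMDiff_ract := hemb.contMDiff_of_comp (E'.contMDiff_ract.comp
      ((hemb.contMDiff.comp contMDiff_fst).prodMk contMDiff_snd))
    locally_trivial := fun x ↦ by
      obtain ⟨i, hi⟩ := hcov x
      exact ⟨φ i, hi, (hφ i).1, (hφ i).2, fun z hz s ↦ i.1.2.map_ract z.1 hz s⟩
    lact := fun p z ↦ ⟨E'.lact p z.1, by
      rw [E'.proj_lact, z.2]
      -- `P` fixes `o`, so its action preserves `T`.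
      exact QuotientGroup.eq.2 (by simp)⟩
    lact_one := fun z ↦ Subtype.ext (E'.lact_one _)
    lact_mul := fun k l z ↦ Subtype.ext (E'.lact_mul _ _ _)
    proj_lact := fun k z ↦ by rw [E'.proj_lact]
    lact_ract := fun k z s ↦ Subtype.ext (E'.lact_ract _ _ _)
    contMDiff_lact := hemb.contMDiff_of_comp (E'.contMDiff_lact.comp
      ((hι.comp contMDiff_fst).prodMk (hemb.contMDiff.comp contMDiff_snd))) },
    Subtype.val, hemb, Subtype.range_val, fun e ↦ Prod.ext rfl e.2, fun e h ↦ rfl,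
    fun p e ↦ rfl⟩

end Restriction

/-! ### The quotient `(E × G)/P` and its local trivializations -/

section Induction

open EquivariantPrincipalBundle

variable {VX VG VP VQ VH : Type*}
  [NormedAddCommGroup VX] [NormedSpace ℂ VX]
  [NormedAddCommGroup VG] [NormedSpace ℂ VG]
  [NormedAddCommGroup VP] [NormedSpace ℂ VP]
  [NormedAddCommGroup VQ] [NormedSpace ℂ VQ]
  [NormedAddCommGroup VH] [NormedSpace ℂ VH]
  {X : Type u} [TopologicalSpace X] [ChartedSpace VX X]
  {G : Type u} [TopologicalSpace G] [ChartedSpace VG G] [Group G]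
  {P : Subgroup G} [ChartedSpace VP P] [ChartedSpace VQ (G ⧸ P)]
  {H : Type u} [TopologicalSpace H] [ChartedSpace VH H] [Group H]

variable (VG VQ P) in
/-- A set-theoretic section of `G → G/P` which is holomorphic on the open subset `baseSet`. -/
structure CosetSection where
  /-- The underlying map. -/
  toFun : G ⧸ P → G
  mk_toFun : ∀ y, (toFun y : G ⧸ P) = y
  /-- An open set on which the section is holomorphic. -/
  baseSet : Set (G ⧸ P)
  isOpen_baseSet : IsOpen baseSet
  contMDiffOn : ContMDiffOn 𝓘(ℂ, VQ) 𝓘(ℂ, VG) ω toFun baseSet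

namespace CosetSection

/-- The submersion `G → G/P` has a holomorphic section near `y`. Off its domain arbitrary coset
representatives are used, so that `toSubgroup` is defined on all of `G`. -/
theorem exists_mem (hQ : IsSubmersion 𝓘(ℂ, VG) 𝓘(ℂ, VQ) ω (QuotientGroup.mk : G → G ⧸ P))
    (y : G ⧸ P) : ∃ σ : CosetSection VG VQ P, y ∈ σ.baseSet := by
  obtain ⟨g, rfl⟩ := QuotientGroup.mk_surjective y
  obtain ⟨s, U, hU, hgU, -, hs, hsec⟩ :=
    (hQ.isSubmersionOfComplement_complement g).exists_localSection
  classical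
  refine ⟨⟨fun y ↦ if y ∈ U then s y else y.out, fun y ↦ ?_, U, hU,
    hs.congr fun y hy ↦ if_pos hy⟩, hgU⟩
  by_cases hy : y ∈ U
  · simp only [if_pos hy, hsec y hy]
  · simp only [if_neg hy, QuotientGroup.out_eq']

variable (σ : CosetSection VG VQ P)

/-- The element `p` of `P` with `g = σ(gP) p`. -/
def toSubgroup (g : G) : P := ⟨(σ.toFun g)⁻¹ * g, QuotientGroup.eq.1 (σ.mk_toFun g)⟩

theorem toFun_mul_toSubgroup (g : G) : σ.toFun g * σ.toSubgroup g = g := by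
  simp [toSubgroup]

/-- Right translation by `P` does not change the coset, hence not the value of `σ`. This
equivariance makes `toTotal` constant on orbits. -/
theorem toSubgroup_mul (g : G) (p : P) : σ.toSubgroup (g * p) = σ.toSubgroup g * p := by
  have : ((g * p : G) : G ⧸ P) = g := QuotientGroup.eq.2 (by simp)
  refine Subtype.ext ?_
  simp [toSubgroup, this, mul_assoc]

theorem toSubgroup_toFun (y : G ⧸ P) : σ.toSubgroup (σ.toFun y) = 1 := by
  refine Subtype.ext ?_
  simp [toSubgroup, σ.mk_toFun]

/-- As a map to `G` it is `g ↦ σ(gP)⁻¹ g`, holomorphic by the group operations; the embedding of `P`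
turns this into holomorphy as a map to `P`. -/
theorem contMDiffOn_toSubgroup [LieGroup 𝓘(ℂ, VG) ω G]
    (hP : IsSmoothEmbedding 𝓘(ℂ, VP) 𝓘(ℂ, VG) ω (Subtype.val : P → G))
    (hQ : ContMDiff 𝓘(ℂ, VG) 𝓘(ℂ, VQ) ω (QuotientGroup.mk : G → G ⧸ P)) :
    ContMDiffOn 𝓘(ℂ, VG) 𝓘(ℂ, VP) ω σ.toSubgroup (QuotientGroup.mk ⁻¹' σ.baseSet) := by
  refine hP.contMDiffOn_of_comp (σ.isOpen_baseSet.preimage hQ.continuous) ?_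
  exact (σ.contMDiffOn.comp hQ.contMDiffOn fun _ h ↦ h).inv.mul contMDiffOn_id

end CosetSection

variable (E : BunTrivialAction VX VP VH X P H)

/-- The orbit relation of `P` on `p₁^* E = E × G`. -/
def inductionSetoid : Setoid (E.Total × G) where
  r w w' := ∃ p : P, w'.1 = E.lact p w.1 ∧ w'.2 = w.2 * (p : G)⁻¹
  iseqv :=
    { refl := fun w ↦ ⟨1, by simp [E.lact_one]⟩
      symm := by
        rintro ⟨e, g⟩ ⟨e', g'⟩ ⟨p, rfl, rfl⟩
        exact ⟨p⁻¹, by simp [← E.lact_mul, E.lact_one]⟩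
      trans := by
        rintro ⟨e, g⟩ ⟨e', g'⟩ ⟨e'', g''⟩ ⟨p, rfl, rfl⟩ ⟨p', rfl, rfl⟩
        exact ⟨p' * p, by simp [E.lact_mul, mul_assoc]⟩ }

/-- The total space `(p₁^* E)/P` of the induced bundle. -/
abbrev InductionTotal : Type u := Quotient (inductionSetoid E)

namespace InductionTotal

/-- The quotient map `E × G → (E × G)/P`. -/
def mk (w : E.Total × G) : InductionTotal E := Quotient.mk (inductionSetoid E) w

theorem mk_eq_mk_iff (e₁ : E.Total) (g₁ : G) (e₂ : E.Total) (g₂ : G) :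
    mk E (e₁, g₁) = mk E (e₂, g₂) ↔ ∃ p : P, e₂ = E.lact p e₁ ∧ g₂ = g₁ * (p : G)⁻¹ :=
  Quotient.eq (r := inductionSetoid E)

theorem mk_surjective : Function.Surjective (mk E) := Quotient.mk_surjective

theorem isQuotientMap_mk : IsQuotientMap (mk E) := isQuotientMap_quotient_mk'

theorem mk_lact (p : P) (e : E.Total) (g : G) : mk E (E.lact p e, g) = mk E (e, g * p) :=
  ((mk_eq_mk_iff E _ _ _ _).2 ⟨p, rfl, by simp⟩).symm

/-- The projection of the induced bundle. -/
def proj : InductionTotal E → X × (G ⧸ P) :=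
  Quotient.lift (fun w ↦ (E.proj w.1, (w.2 : G ⧸ P))) (by
    rintro ⟨e, g⟩ ⟨e', g'⟩ ⟨p, rfl, rfl⟩
    exact Prod.ext (E.proj_lact p e).symm (QuotientGroup.eq.2 (by simp)))

theorem proj_mk (e : E.Total) (g : G) : proj E (mk E (e, g)) = (E.proj e, (g : G ⧸ P)) := rfl

/-- The action of the structure group on the induced bundle. -/
def ract (t : InductionTotal E) (h : H) : InductionTotal E :=
  Quotient.lift (fun w ↦ mk E (E.ract w.1 h, w.2)) (by
    rintro ⟨e, g⟩ ⟨e', g'⟩ ⟨p, rfl, rfl⟩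
    exact (mk_eq_mk_iff E _ _ _ _).2 ⟨p, (E.lact_ract p e h).symm, rfl⟩) t

theorem ract_mk (e : E.Total) (g : G) (h : H) :
    ract E (mk E (e, g)) h = mk E (E.ract e h, g) := rfl

/-- The action of `G` on the induced bundle. -/
def lact (g' : G) (t : InductionTotal E) : InductionTotal E :=
  Quotient.lift (fun w ↦ mk E (w.1, g' * w.2)) (by
    rintro ⟨e, g⟩ ⟨e', g'⟩ ⟨p, rfl, rfl⟩
    exact (mk_eq_mk_iff E _ _ _ _).2 ⟨p, rfl, (mul_assoc _ _ _).symm⟩) t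

theorem lact_mk (g' : G) (e : E.Total) (g : G) :
    lact E g' (mk E (e, g)) = mk E (e, g' * g) := rfl

variable (σ : CosetSection VG VQ P)

/-- The component in `E` of the identification of `(E × G)/P` with `E × G/P` by a section of
`G → G/P`. -/
def toTotal : InductionTotal E → E.Total :=
  Quotient.lift (fun w ↦ E.lact (σ.toSubgroup w.2) w.1) (by
    rintro ⟨e, g⟩ ⟨e', g'⟩ ⟨p, rfl, rfl⟩
    change E.lact (σ.toSubgroup g) e = E.lact (σ.toSubgroup (g * ((p⁻¹ : P) : G))) (E.lact p e)
    rw [σ.toSubgroup_mul, ← E.lact_mul, inv_mul_cancel_right])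

theorem toTotal_mk (e : E.Total) (g : G) :
    toTotal E σ (mk E (e, g)) = E.lact (σ.toSubgroup g) e := rfl

theorem toTotal_mk_toFun (e : E.Total) (y : G ⧸ P) : toTotal E σ (mk E (e, σ.toFun y)) = e := by
  rw [toTotal_mk, σ.toSubgroup_toFun, E.lact_one]

theorem proj_toTotal (t : InductionTotal E) : E.proj (toTotal E σ t) = (proj E t).1 := by
  obtain ⟨⟨e, g⟩, rfl⟩ := mk_surjective E t
  exact E.proj_lact _ e

/-- Every orbit meets the image of `σ` in the second factor: with `g = σ(gP) p`, acting by `p` turns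
`(e, g)` into `(p · e, σ(gP))`. -/
theorem mk_toTotal (t : InductionTotal E) : mk E (toTotal E σ t, σ.toFun (proj E t).2) = t := by
  obtain ⟨⟨e, g⟩, rfl⟩ := mk_surjective E t
  rw [toTotal_mk, mk_lact, proj_mk, σ.toFun_mul_toSubgroup]

theorem toTotal_ract (t : InductionTotal E) (h : H) :
    toTotal E σ (ract E t h) = E.ract (toTotal E σ t) h := by
  obtain ⟨⟨e, g⟩, rfl⟩ := mk_surjective E t
  rw [ract_mk, toTotal_mk, toTotal_mk, E.lact_ract]

variable [LieGroup 𝓘(ℂ, VG) ω G]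

theorem continuous_proj : Continuous (proj E) :=
  (isQuotientMap_mk E).continuous_iff.2
    ((E.contMDiff_proj.continuous.comp continuous_fst).prodMk
      (continuous_quotient_mk'.comp continuous_snd))

/-- Stated on `E × G`, since the quotient has no complex structure yet; there the map is the action
of the holomorphic `toSubgroup`. -/
theorem contMDiffOn_toTotal_comp_mk
    (hP : IsSmoothEmbedding 𝓘(ℂ, VP) 𝓘(ℂ, VG) ω (Subtype.val : P → G))
    (hQ : ContMDiff 𝓘(ℂ, VG) 𝓘(ℂ, VQ) ω (QuotientGroup.mk : G → G ⧸ P)) :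
    ContMDiffOn ((𝓘(ℂ, VX).prod 𝓘(ℂ, VH)).prod 𝓘(ℂ, VG)) (𝓘(ℂ, VX).prod 𝓘(ℂ, VH)) ω
      (toTotal E σ ∘ mk E) {w | (w.2 : G ⧸ P) ∈ σ.baseSet} :=
  E.contMDiff_lact.comp_contMDiffOn
    (((σ.contMDiffOn_toSubgroup hP hQ).comp contMDiffOn_snd fun _ h ↦ h).prodMk contMDiffOn_fst)

/-- Continuity descends because a quotient map remains one over an open subset. -/
theorem continuousOn_toTotal
    (hP : IsSmoothEmbedding 𝓘(ℂ, VP) 𝓘(ℂ, VG) ω (Subtype.val : P → G))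
    (hQ : ContMDiff 𝓘(ℂ, VG) 𝓘(ℂ, VQ) ω (QuotientGroup.mk : G → G ⧸ P)) :
    ContinuousOn (toTotal E σ) {t | (proj E t).2 ∈ σ.baseSet} :=
  ((isQuotientMap_mk E).continuousOn_isOpen_iff
    (σ.isOpen_baseSet.preimage (continuous_snd.comp (continuous_proj E)))).2
    (contMDiffOn_toTotal_comp_mk E σ hP hQ).continuousOn

/-- The local trivialization of the induced bundle given by a local trivialization of `E` and a
local section of `G → G/P`. -/
def trivialization
    (hP : IsSmoothEmbedding 𝓘(ℂ, VP) 𝓘(ℂ, VG) ω (Subtype.val : P → G))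
    (hQ : ContMDiff 𝓘(ℂ, VG) 𝓘(ℂ, VQ) ω (QuotientGroup.mk : G → G ⧸ P))
    (e : Bundle.Trivialization H E.proj) : Bundle.Trivialization H (proj E) where
  toFun t := (proj E t, (e (toTotal E σ t)).2)
  invFun w := mk E (e.toOpenPartialHomeomorph.symm (w.1.1, w.2), σ.toFun w.1.2)
  source := proj E ⁻¹' (e.baseSet ×ˢ σ.baseSet)
  target := (e.baseSet ×ˢ σ.baseSet) ×ˢ univ
  baseSet := e.baseSet ×ˢ σ.baseSet
  open_baseSet := e.open_baseSet.prod σ.isOpen_baseSet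
  open_source := (e.open_baseSet.prod σ.isOpen_baseSet).preimage (continuous_proj E)
  open_target := (e.open_baseSet.prod σ.isOpen_baseSet).prod isOpen_univ
  source_eq := rfl
  target_eq := rfl
  proj_toFun _ _ := rfl
  map_source' t ht := ⟨ht, mem_univ _⟩
  map_target' w hw := by
    rw [mem_preimage, proj_mk, e.proj_symm_apply' hw.1.1, σ.mk_toFun]
    exact hw.1
  left_inv' t ht := by
    have h1 : toTotal E σ t ∈ e.source := e.mem_source.2 (by rw [proj_toTotal]; exact ht.1)
    change mk E (e.toOpenPartialHomeomorph.symm ((proj E t).1, (e (toTotal E σ t)).2),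
      σ.toFun (proj E t).2) = t
    rw [← proj_toTotal E σ t, e.symm_apply_mk_proj h1, mk_toTotal]
  right_inv' w hw := by
    rw [toTotal_mk_toFun, proj_mk, e.proj_symm_apply' hw.1.1, σ.mk_toFun,
      e.apply_symm_apply (e.mem_target.2 hw.1.1)]
  continuousOn_toFun := by
    refine (continuous_proj E).continuousOn.prodMk (continuous_snd.comp_continuousOn
      (e.continuousOn_toFun.comp ((continuousOn_toTotal E σ hP hQ).mono fun t ht ↦ ht.2)
        fun t ht ↦ e.mem_source.2 ?_))
    rw [proj_toTotal]
    exact ht.1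
  continuousOn_invFun := by
    refine (isQuotientMap_mk E).continuous.comp_continuousOn (ContinuousOn.prodMk ?_ ?_)
    · exact e.toOpenPartialHomeomorph.continuousOn_symm.comp (by fun_prop)
        fun w hw ↦ e.mem_target.2 hw.1.1
    · exact σ.contMDiffOn.continuousOn.comp (by fun_prop) fun w hw ↦ hw.1.2

end InductionTotal

end Induction

/-! ### Complex structure on the quotient and existence of the induced bundle -/

section InductionExistence

open EquivariantPrincipalBundle InductionTotal

variable {VX VG VP VQ VH : Type*}
  [NormedAddCommGroup VX] [NormedSpace ℂ VX]
  [NormedAddCommGroup VG] [NormedSpace ℂ VG]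
  [NormedAddCommGroup VP] [NormedSpace ℂ VP]
  [NormedAddCommGroup VQ] [NormedSpace ℂ VQ]
  [NormedAddCommGroup VH] [NormedSpace ℂ VH]
  {X : Type u} [TopologicalSpace X] [ChartedSpace VX X]
  {G : Type u} [TopologicalSpace G] [ChartedSpace VG G] [Group G] [LieGroup 𝓘(ℂ, VG) ω G]
  {P : Subgroup G} [ChartedSpace VP P] [ChartedSpace VQ (G ⧸ P)]
  {H : Type u} [TopologicalSpace H] [ChartedSpace VH H] [Group H]

/-- Over a trivializing open subset of `X` and the domain of a section of `G → G/P`, the quotient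
map `E × G → (E × G)/P` becomes `((x, h), g) ↦ ((x, gP), h)` in these coordinates on `E × G`. -/
def inductionChart [LieGroup 𝓘(ℂ, VP) ω P] (E : BunTrivialAction VX VP VH X P H)
    (hP : IsSmoothEmbedding 𝓘(ℂ, VP) 𝓘(ℂ, VG) ω (Subtype.val : P → G))
    (hQ : ContMDiff 𝓘(ℂ, VG) 𝓘(ℂ, VQ) ω (QuotientGroup.mk : G → G ⧸ P))
    (σ : CosetSection VG VQ P) (e : Bundle.Trivialization H E.proj) :
    OpenPartialHomeomorph (E.Total × G) ((X × H) × G) where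
  -- Acting by `p = σ(gP)⁻¹ g` makes the first component constant on `P`-orbits, so the quotient
  -- affects only `g`.
  toFun w := (e (E.lact (σ.toSubgroup w.2) w.1), w.2)
  invFun v := (E.lact (σ.toSubgroup v.2)⁻¹ (e.toOpenPartialHomeomorph.symm v.1), v.2)
  source := {w | E.proj w.1 ∈ e.baseSet ∧ (w.2 : G ⧸ P) ∈ σ.baseSet}
  target := {v | v.1.1 ∈ e.baseSet ∧ (v.2 : G ⧸ P) ∈ σ.baseSet}
  open_source := (e.open_baseSet.preimage (E.contMDiff_proj.continuous.comp continuous_fst)).inter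
    (σ.isOpen_baseSet.preimage (hQ.continuous.comp continuous_snd))
  open_target := (e.open_baseSet.preimage (continuous_fst.comp continuous_fst)).inter
    (σ.isOpen_baseSet.preimage (hQ.continuous.comp continuous_snd))
  map_source' w hw := by
    have h1 : E.lact (σ.toSubgroup w.2) w.1 ∈ e.source :=
      e.mem_source.2 (by rw [E.proj_lact]; exact hw.1)
    exact ⟨e.mem_target.1 (e.map_source h1), hw.2⟩
  map_target' v hv := by
    refine ⟨?_, hv.2⟩
    rw [E.proj_lact, e.proj_symm_apply (e.mem_target.2 hv.1)]
    exact hv.1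
  left_inv' w hw := by
    have h1 : E.lact (σ.toSubgroup w.2) w.1 ∈ e.source :=
      e.mem_source.2 (by rw [E.proj_lact]; exact hw.1)
    refine Prod.ext ?_ rfl
    change E.lact (σ.toSubgroup w.2)⁻¹ (e.toOpenPartialHomeomorph.symm
      (e.toOpenPartialHomeomorph (E.lact (σ.toSubgroup w.2) w.1))) = w.1
    rw [e.toOpenPartialHomeomorph.left_inv h1, ← E.lact_mul, inv_mul_cancel, E.lact_one]
  right_inv' v hv := by
    refine Prod.ext ?_ rfl
    change e (E.lact (σ.toSubgroup v.2) (E.lact (σ.toSubgroup v.2)⁻¹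
      (e.toOpenPartialHomeomorph.symm v.1))) = v.1
    rw [← E.lact_mul, mul_inv_cancel, E.lact_one, e.apply_symm_apply (e.mem_target.2 hv.1)]
  continuousOn_toFun := by
    refine ContinuousOn.prodMk (e.continuousOn_toFun.comp
      ((contMDiffOn_toTotal_comp_mk E σ hP hQ).continuousOn.mono fun w hw ↦ hw.2)
      fun w hw ↦ e.mem_source.2 ?_) continuousOn_snd
    rw [E.proj_lact]
    exact hw.1
  continuousOn_invFun := by
    refine ContinuousOn.prodMk (E.contMDiff_lact.continuous.comp_continuousOn
      (ContinuousOn.prodMk ?_ ?_)) continuousOn_snd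
    · exact ((σ.contMDiffOn_toSubgroup hP hQ).inv).continuousOn.comp continuousOn_snd
        fun v hv ↦ hv.2
    · exact e.toOpenPartialHomeomorph.continuousOn_symm.comp continuousOn_fst
        fun v hv ↦ e.mem_target.2 hv.1

theorem contMDiffOn_inductionChart [LieGroup 𝓘(ℂ, VP) ω P]
    (E : BunTrivialAction VX VP VH X P H)
    (hP : IsSmoothEmbedding 𝓘(ℂ, VP) 𝓘(ℂ, VG) ω (Subtype.val : P → G))
    (hQ : ContMDiff 𝓘(ℂ, VG) 𝓘(ℂ, VQ) ω (QuotientGroup.mk : G → G ⧸ P))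
    (σ : CosetSection VG VQ P) {e : Bundle.Trivialization H E.proj}
    (he : E.IsHolTrivialization e) :
    ContMDiffOn ((𝓘(ℂ, VX).prod 𝓘(ℂ, VH)).prod 𝓘(ℂ, VG))
      ((𝓘(ℂ, VX).prod 𝓘(ℂ, VH)).prod 𝓘(ℂ, VG)) ω (inductionChart E hP hQ σ e)
      (inductionChart E hP hQ σ e).source := by
  refine ContMDiffOn.prodMk (he.contMDiffOn.comp
    ((contMDiffOn_toTotal_comp_mk E σ hP hQ).mono fun w hw ↦ hw.2)
    fun w hw ↦ e.mem_source.2 ?_) contMDiffOn_snd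
  rw [E.proj_lact]
  exact hw.1

/-- The twist by `toSubgroup` is undone by its inverse, holomorphic because inversion in `P` is. -/
theorem contMDiffOn_inductionChart_symm [LieGroup 𝓘(ℂ, VP) ω P]
    (E : BunTrivialAction VX VP VH X P H)
    (hP : IsSmoothEmbedding 𝓘(ℂ, VP) 𝓘(ℂ, VG) ω (Subtype.val : P → G))
    (hQ : ContMDiff 𝓘(ℂ, VG) 𝓘(ℂ, VQ) ω (QuotientGroup.mk : G → G ⧸ P))
    (σ : CosetSection VG VQ P) {e : Bundle.Trivialization H E.proj}
    (he : E.IsHolTrivialization e) :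
    ContMDiffOn ((𝓘(ℂ, VX).prod 𝓘(ℂ, VH)).prod 𝓘(ℂ, VG))
      ((𝓘(ℂ, VX).prod 𝓘(ℂ, VH)).prod 𝓘(ℂ, VG)) ω (inductionChart E hP hQ σ e).symm
      (inductionChart E hP hQ σ e).target := by
  refine ContMDiffOn.prodMk (E.contMDiff_lact.comp_contMDiffOn
    (ContMDiffOn.prodMk ?_ ?_)) contMDiffOn_snd
  · exact (σ.contMDiffOn_toSubgroup hP hQ).inv.comp contMDiffOn_snd fun v hv ↦ hv.2
  · exact he.contMDiffOn_symm.comp contMDiffOn_fst fun v hv ↦ e.mem_target.2 hv.1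

/-- The transition maps between local trivializations of the induced bundle are holomorphic. -/
theorem contMDiffOn_trivialization_transition
    (E : BunTrivialAction VX VP VH X P H)
    (hP : IsSmoothEmbedding 𝓘(ℂ, VP) 𝓘(ℂ, VG) ω (Subtype.val : P → G))
    (hQ : ContMDiff 𝓘(ℂ, VG) 𝓘(ℂ, VQ) ω (QuotientGroup.mk : G → G ⧸ P))
    (σ : CosetSection VG VQ P) {e : Bundle.Trivialization H E.proj}
    (he : E.IsHolTrivialization e)
    {e' : Bundle.Trivialization H E.proj}
    (he' : E.IsHolTrivialization e') (σ' : CosetSection VG VQ P) :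
    ContMDiffOn ((𝓘(ℂ, VX).prod 𝓘(ℂ, VQ)).prod 𝓘(ℂ, VH))
      ((𝓘(ℂ, VX).prod 𝓘(ℂ, VQ)).prod 𝓘(ℂ, VH)) ω
      ((trivialization E σ hP hQ e).toOpenPartialHomeomorph.symm ≫ₕ
        (trivialization E σ' hP hQ e').toOpenPartialHomeomorph)
      ((trivialization E σ hP hQ e).toOpenPartialHomeomorph.symm ≫ₕ
        (trivialization E σ' hP hQ e').toOpenPartialHomeomorph).source := by
  set W := ((trivialization E σ hP hQ e).toOpenPartialHomeomorph.symm ≫ₕ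
        (trivialization E σ' hP hQ e').toOpenPartialHomeomorph).source
  have hW : ∀ w ∈ W, w.1 ∈ e.baseSet ×ˢ σ.baseSet ∧ w.1 ∈ e'.baseSet ×ˢ σ'.baseSet := by
    intro w hw
    have h1 : w.1 ∈ e.baseSet ×ˢ σ.baseSet := hw.1.1
    have h2 : proj E (mk E (e.toOpenPartialHomeomorph.symm (w.1.1, w.2), σ.toFun w.1.2)) ∈
      e'.baseSet ×ˢ σ'.baseSet := hw.2
    rw [proj_mk, e.proj_symm_apply' h1.1, σ.mk_toFun] at h2
    exact ⟨h1, h2⟩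
  have h1 : ContMDiffOn ((𝓘(ℂ, VX).prod 𝓘(ℂ, VQ)).prod 𝓘(ℂ, VH)) (𝓘(ℂ, VX).prod 𝓘(ℂ, VH)) ω
      (fun w : (X × (G ⧸ P)) × H ↦ e.toOpenPartialHomeomorph.symm (w.1.1, w.2)) W :=
    he.contMDiffOn_symm.comp
      ((contMDiff_fst.comp contMDiff_fst).prodMk contMDiff_snd).contMDiffOn
      fun w hw ↦ e.mem_target.2 (hW w hw).1.1
  have h2 : ContMDiffOn ((𝓘(ℂ, VX).prod 𝓘(ℂ, VQ)).prod 𝓘(ℂ, VH)) 𝓘(ℂ, VG) ω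
      (fun w : (X × (G ⧸ P)) × H ↦ σ.toFun w.1.2) W :=
    σ.contMDiffOn.comp (contMDiff_snd.comp contMDiff_fst).contMDiffOn fun w hw ↦ (hW w hw).1.2
  -- At `((x, y), h)` this applies `e'` to the point of `E` with `e`-coordinates `(x, h)`, moved by
  -- `σ'(y)⁻¹ σ(y)` in `P`; no complex structure on the quotient is involved.
  have h3 := he'.contMDiffOn.comp ((contMDiffOn_toTotal_comp_mk E σ' hP hQ).comp (h1.prodMk h2)
    fun w hw ↦ by
      rw [mem_preimage, mem_ofPred_eq, σ.mk_toFun]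
      exact (hW w hw).2.2) fun w hw ↦ by
    rw [mem_preimage, e'.mem_source, Function.comp_apply, Function.comp_apply, proj_toTotal,
      proj_mk, e.proj_symm_apply' (hW w hw).1.1]
    exact (hW w hw).2.1
  refine (contMDiffOn_fst.prodMk (contMDiff_snd.comp_contMDiffOn h3)).congr fun w hw ↦
    Prod.ext ?_ rfl
  change proj E (mk E (e.toOpenPartialHomeomorph.symm (w.1.1, w.2), σ.toFun w.1.2)) = w.1
  rw [proj_mk, e.proj_symm_apply' (hW w hw).1.1, σ.mk_toFun]

variable [LieGroup 𝓘(ℂ, VP) ω P] [IsManifold 𝓘(ℂ, VX) ω X]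
  [IsManifold 𝓘(ℂ, VQ) ω (G ⧸ P)] [LieGroup 𝓘(ℂ, VH) ω H]

/-- Every `P`-equivariant bundle on `X` has an induced bundle on `X × G/P`. -/
theorem exists_isInduction
    (hP : IsSmoothEmbedding 𝓘(ℂ, VP) 𝓘(ℂ, VG) ω (Subtype.val : P → G))
    (hQ : IsSubmersion 𝓘(ℂ, VG) 𝓘(ℂ, VQ) ω (QuotientGroup.mk : G → G ⧸ P))
    (E : BunTrivialAction VX VP VH X P H) :
    ∃ (E' : BunProductFlag VX VG VQ VH X P H) (q : E.Total × G → E'.Total),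
      IsInduction E E' q := by
  let ι := {e : Bundle.Trivialization H E.proj // E.IsHolTrivialization e} × CosetSection VG VQ P
  let φ (i : ι) := trivialization E i.2 hP hQ.contMDiff i.1.1
  have hcov : ∀ y, ∃ i, y ∈ (φ i).baseSet := by
    intro y
    obtain ⟨e, hx, he⟩ := E.exists_isHolTrivialization y.1
    obtain ⟨σ, hσ⟩ := CosetSection.exists_mem hQ y.2
    exact ⟨⟨⟨e, he⟩, σ⟩, hx, hσ⟩
  obtain ⟨c, hT, hφ⟩ := exists_chartedSpace_of_compatible
    (I := (𝓘(ℂ, VX).prod 𝓘(ℂ, VQ)).prod 𝓘(ℂ, VH)) (n := ω)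
    (fun i ↦ (φ i).toOpenPartialHomeomorph)
    (fun z ↦ by
      obtain ⟨i, hi⟩ := hcov (proj E z)
      exact ⟨i, (φ i).mem_source.2 hi⟩)
    (fun i k ↦ contMDiffOn_trivialization_transition E hP hQ.contMDiff i.2 i.1.2 k.1.2 k.2)
  have hq : IsSubmersion ((𝓘(ℂ, VX).prod 𝓘(ℂ, VH)).prod 𝓘(ℂ, VG))
      ((𝓘(ℂ, VX).prod 𝓘(ℂ, VQ)).prod 𝓘(ℂ, VH)) ω (mk E) := by
    refine IsSubmersionOfComplement.isSubmersion (F := hQ.complement) fun w ↦ ?_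
    obtain ⟨i, hi⟩ := hcov (proj E (mk E w))
    -- In these charts `mk E` becomes `((x, h), g) ↦ ((x, gP), h)`, a submersion because `G → G/P`
    -- is one.
    refine IsSubmersionAtOfComplement.of_conj (inductionChart E hP hQ.contMDiff i.2 i.1.1)
      (contMDiffOn_inductionChart E hP hQ.contMDiff i.2 i.1.2)
      (contMDiffOn_inductionChart_symm E hP hQ.contMDiff i.2 i.1.2)
      (φ i).toOpenPartialHomeomorph (hφ i).1 (hφ i).2 (fun y hy ↦ hy) (fun y hy ↦ ?_) hi
      (hQ.isSubmersionOfComplement_complement _).prodRightComm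
    have h1 : E.lact (i.2.toSubgroup y.2) y.1 ∈ i.1.1.source :=
      i.1.1.mem_source.2 (by rw [E.proj_lact]; exact hy.1)
    refine Prod.ext (Prod.ext ?_ rfl) rfl
    -- `P` acts trivially on `X`, so the twist in `inductionChart` leaves the base point unchanged.
    exact (E.proj_lact _ _).symm.trans (i.1.1.coe_fst h1).symm
  have hsurj := mk_surjective E
  refine ⟨{
    Total := InductionTotal E
    proj := proj E
    contMDiff_proj := hq.contMDiff_of_comp hsurj
      ((E.contMDiff_proj.comp contMDiff_fst).prodMk (hQ.contMDiff.comp contMDiff_snd))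
    ract := ract E
    ract_one := fun z ↦ by
      obtain ⟨⟨e, g⟩, rfl⟩ := hsurj z
      rw [ract_mk, E.ract_one]
    ract_mul := fun z s t ↦ by
      obtain ⟨⟨e, g⟩, rfl⟩ := hsurj z
      rw [ract_mk, ract_mk, ract_mk, E.ract_mul]
    proj_ract := fun z s ↦ by
      obtain ⟨⟨e, g⟩, rfl⟩ := hsurj z
      rw [ract_mk, proj_mk, proj_mk, E.proj_ract]
    -- The product of `mk E` with an identity is again a surjective submersion, so holomorphy of the
    -- action descends from `E × G`; the same holds for `lact`.
    contMDiff_ract := (hq.prodMap IsSubmersion.id).contMDiff_of_comp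
      (hsurj.prodMap Function.surjective_id) (hq.contMDiff.comp
        ((E.contMDiff_ract.comp ((contMDiff_fst.comp contMDiff_fst).prodMk contMDiff_snd)).prodMk
          (contMDiff_snd.comp contMDiff_fst)))
    locally_trivial := fun y ↦ by
      obtain ⟨i, hi⟩ := hcov y
      refine ⟨φ i, hi, (hφ i).1, (hφ i).2, fun z hz s ↦ ?_⟩
      change (i.1.1 (toTotal E i.2 (ract E z s))).2 = (i.1.1 (toTotal E i.2 z)).2 * s
      rw [toTotal_ract, i.1.2.map_ract _ (i.1.1.mem_source.2 ?_)]
      rw [proj_toTotal]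
      exact ((φ i).mem_source.1 hz).1
    lact := lact E
    lact_one := fun z ↦ by
      obtain ⟨⟨e, g⟩, rfl⟩ := hsurj z
      rw [lact_mk, one_mul]
    lact_mul := fun k l z ↦ by
      obtain ⟨⟨e, g⟩, rfl⟩ := hsurj z
      rw [lact_mk, lact_mk, lact_mk, mul_assoc]
    proj_lact := fun k z ↦ by
      obtain ⟨⟨e, g⟩, rfl⟩ := hsurj z
      rfl
    lact_ract := fun k z s ↦ by
      obtain ⟨⟨e, g⟩, rfl⟩ := hsurj z
      rfl
    contMDiff_lact := (IsSubmersion.id.prodMap hq).contMDiff_of_comp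
      (Function.surjective_id.prodMap hsurj) (hq.contMDiff.comp
        ((contMDiff_fst.comp contMDiff_snd).prodMk
          (contMDiff_fst.mul (contMDiff_snd.comp contMDiff_snd)))) },
    mk E, hsurj, hq, mk_eq_mk_iff E, fun e g ↦ rfl, fun e g h ↦ rfl, fun g' e g ↦ rfl⟩

end InductionExistence

end

theorem mainTheorem9
    {VX VG VP VQ VH : Type*}
    [NormedAddCommGroup VX] [NormedSpace ℂ VX] [FiniteDimensional ℂ VX]
    [NormedAddCommGroup VG] [NormedSpace ℂ VG] [FiniteDimensional ℂ VG]
    [NormedAddCommGroup VP] [NormedSpace ℂ VP] [FiniteDimensional ℂ VP]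
    [NormedAddCommGroup VQ] [NormedSpace ℂ VQ] [FiniteDimensional ℂ VQ]
    [NormedAddCommGroup VH] [NormedSpace ℂ VH] [FiniteDimensional ℂ VH]
    -- `X` is a complex manifold
    (X : Type u) [TopologicalSpace X] [ChartedSpace VX X] [IsManifold 𝓘(ℂ, VX) ω X]
    -- `G` and `H` are complex Lie groups
    (G : Type u) [TopologicalSpace G] [ChartedSpace VG G] [Group G] [LieGroup 𝓘(ℂ, VG) ω G]
    (H : Type u) [TopologicalSpace H] [ChartedSpace VH H] [Group H] [LieGroup 𝓘(ℂ, VH) ω H]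
    -- `P` is a closed complex Lie subgroup of `G`
    (P : Subgroup G) (hPclosed : IsClosed (P : Set G))
    [ChartedSpace VP P] [LieGroup 𝓘(ℂ, VP) ω P]
    (hP : Manifold.IsSmoothEmbedding 𝓘(ℂ, VP) 𝓘(ℂ, VG) ω (Subtype.val : P → G))
    -- `G/P` carries its quotient complex structure (the one for which `G → G/P` is a submersion)
    [ChartedSpace VQ (G ⧸ P)] [IsManifold 𝓘(ℂ, VQ) ω (G ⧸ P)]
    (hQ : Manifold.IsSubmersion 𝓘(ℂ, VG) 𝓘(ℂ, VQ) ω (QuotientGroup.mk : G → G ⧸ P)) :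
    -- `Φ.functor` is restriction to the slice, `Φ.inverse` is induction
    ∃ (Φ : BunProductFlag VX VG VQ VH X P H ≌ BunTrivialAction VX VP VH X P H)
      (j : ∀ E' : BunProductFlag VX VG VQ VH X P H, (Φ.functor.obj E').Total → E'.Total)
      (q : ∀ E : BunTrivialAction VX VP VH X P H, E.Total × G → (Φ.inverse.obj E).Total),
      (∀ E', IsSliceRestriction E' (Φ.functor.obj E') (j E')) ∧
      (∀ E, IsInduction E (Φ.inverse.obj E) (q E)) ∧
      -- the action of the two functors on morphisms
      (∀ (E' F' : BunProductFlag VX VG VQ VH X P H) (f : E' ⟶ F') (e : (Φ.functor.obj E').Total),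
        j F' (EquivariantPrincipalBundle.mapTotal (Φ.functor.map f) e) =
          EquivariantPrincipalBundle.mapTotal f (j E' e)) ∧
      (∀ (E F : BunTrivialAction VX VP VH X P H) (f : E ⟶ F) (e : E.Total) (g : G),
        q F (EquivariantPrincipalBundle.mapTotal f e, g) =
          EquivariantPrincipalBundle.mapTotal (Φ.inverse.map f) (q E (e, g))) ∧
      -- the unit sends `g · e` to the class of `(e, g)`, for `e` in the restriction to the slice
      (∀ (E' : BunProductFlag VX VG VQ VH X P H) (e : (Φ.functor.obj E').Total) (g : G),
        EquivariantPrincipalBundle.mapTotal (Φ.unitIso.hom.app E') (E'.lact g (j E' e)) =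
          q (Φ.functor.obj E') (e, g)) ∧
      -- the counit sends the class of `(e, 1)` to `e`
      (∀ (E : BunTrivialAction VX VP VH X P H) (e : E.Total),
        j (Φ.inverse.obj E)
          (EquivariantPrincipalBundle.mapTotal (Φ.counitIso.inv.app E) e) = q E (e, 1)) :=
  exists_equivalence_of_isSliceRestriction_of_isInduction
    (exists_isSliceRestriction hP.contMDiff) (exists_isInduction hP hQ)
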